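/- Strings are finite binary strings; $\mathrm{occ}(w,x)$ is the number of strings $u$ such that $uw$ is a prefix of $x$. **The sequence $S$.** A de Bruijn string of order $n\ge 1$ is a string $x$ of length $2^n$ that, viewed cyclically, contains every string of length $n$ exactly once; $db(n)$ is the lexicographically least one, and $db_i(n)$ is $db(n)$ shifted cyclically to the left by $i$ bits. For $n=2^s t$ with $t$ odd let $S_n=B_{n,0}B_{n,1}\cdots B_{n,2^s-1}$, where $B_{n,i}=(db_i(n))^t$, and let $S=S_1S_2S_3\cdots$. **The compressors.** After the input $x$ has been read, the count of the bit $b$ in a context (a string) $c$ is $\mathrm{occ}(cb,x)$, and the count of the escape symbol in $c$ is the number of $b\in\{0,1\}$ with positive count in $c$; $c$ is deterministic if its escape count is $1$. The probability of a symbol (bit or escape) in $c$ is its count divided by the sum of the three counts. The model of Bounded PPM with bound $k\in\mathbb N$, $\mathrm{PPM}_k$, consists of all $c$ with $|c|\le k$ and positive escape count. The model of $\mathrm{PPM}^*$ consists of all $c$ with positive escape count such that $c$ is empty or $c=wb$ with $b$ a bit and $\mathrm{occ}(w,x)\ge 2$. The relevant contexts are the suffixes of $x$ in the model. To encode the next bit,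 $\mathrm{PPM}_k$ starts at the longest relevant context, while $\mathrm{PPM}^*$ starts at the shortest deterministic relevant context, or at the longest relevant context if none is deterministic. If the bit has count $0$ in the current context, an escape is transmitted there and the next shorter relevant context becomes current; otherwise the bit is encoded there. If no relevant context is left, the bit is encoded with probability $\frac12$. Each transmitted symbol narrows the current interval, initially $[0,1)$, to a subinterval proportional to its probability (arithmetic encoding). If the final interval is $[a,b)$, the output is the string of the first $L=\lceil-\log_2(b-a)\rceil$ binary digits of the least multiple of $2^{-L}$ in $[a,b)$. For a compressor $T$ let $\rho_T(S)=\liminf_{n\to\infty}|T(S\upharpoonright n)|/n$ and $R_T(S)=\limsup_{n\to\infty}|T(S\upharpoonright n)|/n$, where $S\upharpoonright n$ is the prefix of $S$ of length $n$. **Theorem.** For this sequence $S$: 1. $R_{\mathrm{PPM}^*}(S)=0$; 2. for every $k\in\mathbb N$, $\rho_{\mathrm{PPM}_k}(S)\ge \frac12$; 3. for all $0\le k<n$, every string $x$ of length $k$ is followed equally often by $0$ and by $1$ at its occurrences that begin in $S_n$: if $y$ denotes $S_n$ followed by the first $k$ bits of $S_{n+1}$, then $\mathrm{occ}(x0,y)=\mathrm{occ}(x1,y)=n\,2^{n-k-1}$.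 -/

import Mathlib

open Filter
open scoped ENNReal

/-! Finite binary strings are `List Bool` (`false` is the bit 0, `true` is the bit 1) and
infinite binary sequences are functions `ℕ → Bool`. -/

namespace PPM

/-! ### Strings, occurrences, compression ratios -/

/-- The number of occurrences of `w` as a substring of `x`, that is the number of strings `u` such
that `u ++ w` is a prefix of `x`.  Such `u` correspond to the suffixes of `x` that have `w` as a
prefix. -/
def occ (w x : List Bool) : ℕ := x.tails.countP fun y => w.isPrefixOf y

/-- The definition of `occ` counts what it should. -/
theorem occ_eq_ncard (w x : List Bool) :
    occ w x = Set.ncard {u : List Bool | u ++ w <+: x} := by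
  have hfin : ∀ z : List Bool, {u : List Bool | u ++ w <+: z}.Finite := fun z =>
    (List.finite_toSet z.inits).subset fun u hu =>
      (List.mem_inits u z).2 ((List.prefix_append u w).trans hu)
  unfold occ
  induction x with
  | nil =>
    cases w with
    | nil => simp
    | cons a w => simp [List.isPrefixOf]
  | cons a x ih =>
    have hset : {u : List Bool | u ++ w <+: a :: x} =
        (if w <+: a :: x then {[]} else ∅) ∪ (List.cons a) '' {u | u ++ w <+: x} := by
      ext u
      cases u with
      | nil => by_cases h : w <+: a :: x <;> simp [h]
      | cons b u =>
        by_cases h : w <+: a :: x <;> simp [h, List.cons_prefix_cons] <;>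
          exact ⟨fun ⟨h1, h2⟩ => ⟨h2, h1.symm⟩, fun ⟨h1, h2⟩ => ⟨h2.symm, h1⟩⟩
    have hf : (if w <+: a :: x then {[]} else ∅ : Set (List Bool)).Finite := by
      split_ifs <;> simp
    rw [hset, Set.ncard_union_eq _ hf ((hfin x).image _), Set.ncard_image_of_injective _ (List.cons_injective), ← ih]
    · rw [List.tails_cons, List.countP_cons, add_comm]
      by_cases h : w <+: a :: x <;> simp [h]
    · by_cases h : w <+: a :: x <;> simp [h]

/-- The prefix of length `n` of a binary sequence. -/
def initSeg (S : ℕ → Bool) (n : ℕ) : List Bool := (List.range n).map S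

/-- The best-case compression ratio `ρ_T(S)`. -/
noncomputable def bestRatio (T : List Bool → List Bool) (S : ℕ → Bool) : ℝ≥0∞ :=
  liminf (fun n : ℕ => ((T (initSeg S n)).length : ℝ≥0∞) / (n : ℝ≥0∞)) atTop

/-- The worst-case compression ratio `R_T(S)`. -/
noncomputable def worstRatio (T : List Bool → List Bool) (S : ℕ → Bool) : ℝ≥0∞ :=
  limsup (fun n : ℕ => ((T (initSeg S n)).length : ℝ≥0∞) / (n : ℝ≥0∞)) atTop

/-! ### Contexts

The content of a model is a function of the input `x` read so far. -/

/-- The frequency count of the bit `b` in the context `c`, after reading `x`: how often `c` has been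
followed by `b`. -/
def freq (x c : List Bool) (b : Bool) : ℕ := occ (c ++ [b]) x

/-- The frequency count of the escape symbol in the context `c` (Method C): the number of distinct
bits that have followed `c`. -/
def escFreq (x c : List Bool) : ℕ :=
  (if 0 < freq x c false then 1 else 0) + (if 0 < freq x c true then 1 else 0)

/-- A context is deterministic if its escape count is 1. -/
def IsDet (x c : List Bool) : Prop := escFreq x c = 1

instance (x c : List Bool) : Decidable (IsDet x c) :=
  inferInstanceAs (Decidable (escFreq x c = 1))

/-- The contexts in the model of Bounded PPM with bound `k`: the strings of length at most `k`
that have been followed by some bit. -/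
def InBoundedModel (k : ℕ) (x c : List Bool) : Prop := c.length ≤ k ∧ 0 < escFreq x c

instance (k : ℕ) (x c : List Bool) : Decidable (InBoundedModel k x c) :=
  inferInstanceAs (Decidable (_ ∧ _))

/-- The contexts in the model of PPM*: the empty context, and `w ++ [b]` whenever `w` has occurred
at least twice; in each case a context enters the model only once it has been followed by some bit,
so that there is something that it predicts. -/
def InStarModel (x c : List Bool) : Prop :=
  (c = [] ∨ 2 ≤ occ c.dropLast x) ∧ 0 < escFreq x c

instance (x c : List Bool) : Decidable (InStarModel x c) :=
  inferInstanceAs (Decidable (_ ∧ _))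

/-- The contexts that Bounded PPM may examine for the bit after `x`, in the order in which
it examines them: the suffixes of `x` in the model, from the longest to the shortest. -/
def boundedContexts (k : ℕ) (x : List Bool) : List (List Bool) :=
  x.tails.filter fun c => decide (InBoundedModel k x c)

/-- The relevant contexts of PPM*: the suffixes of `x` in the model, from the longest to the
shortest. -/
def starRelevant (x : List Bool) : List (List Bool) :=
  x.tails.filter fun c => decide (InStarModel x c)

/-- The contexts that PPM* may examine for the bit after `x`, in the order in which it examines
them: it starts at the shortest deterministic relevant context, or at the longest relevant context
if none is deterministic, and goes down from there. -/
def starContexts (x : List Bool) : List (List Bool) :=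
  match ((starRelevant x).filter fun c => decide (IsDet x c)).getLast? with
  | some d => (starRelevant x).filter fun c => decide (c.length ≤ d.length)
  | none => starRelevant x

/-! ### Arithmetic encoding

The half-open interval `[l, l + w)` is represented by the pair `(l, w)`. -/

/-- The subinterval of `I` that corresponds to the subinterval `J` of `[0, 1)`. -/
def narrow (I J : ℚ × ℚ) : ℚ × ℚ := (I.1 + I.2 * J.1, I.2 * J.2)

/-- The total of the frequency counts in a context, that of the escape symbol included. -/
def totalFreq (x c : List Bool) : ℕ := freq x c false + freq x c true + escFreq x c

/-- The subinterval of `[0, 1)` assigned to the bit `b` in the context `c`.  The order is: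
0, 1, escape. -/
def bitInterval (x c : List Bool) (b : Bool) : ℚ × ℚ :=
  ((if b then (freq x c false : ℚ) else 0) / totalFreq x c, (freq x c b : ℚ) / totalFreq x c)

/-- The subinterval of `[0, 1)` assigned to the escape symbol in the context `c`. -/
def escInterval (x c : List Bool) : ℚ × ℚ :=
  (((freq x c false : ℚ) + freq x c true) / totalFreq x c, (escFreq x c : ℚ) / totalFreq x c)

/-- The intervals of the symbols transmitted for the bit `b` after `x` when the given contexts are
examined in turn: an escape for every context in which `b` has not been seen, until `b` is encoded
in a context in which it has been seen, or, if there is none, by the order `-1` table, where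
both bits have probability `1/2`. -/
def encodeBit (x : List Bool) (b : Bool) : List (List Bool) → List (ℚ × ℚ)
  | [] => [(if b then 1 / 2 else 0, 1 / 2)]
  | c :: cs =>
    if 0 < freq x c b then [bitInterval x c b] else escInterval x c :: encodeBit x b cs

/-- Encoding the remaining input, when `x` has been read and `I` is the current interval;
`ctxs x` lists the contexts to examine after the input `x`. -/
def encodeFrom (ctxs : List Bool → List (List Bool)) : List Bool → ℚ × ℚ → List Bool → ℚ × ℚ
  | _, I, [] => I
  | x, I, b :: rest =>
    encodeFrom ctxs (x ++ [b]) ((encodeBit x b (ctxs x)).foldl narrow I) rest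

/-- The number `⌈-log₂ w⌉` of bits that specify a point of an interval of length `w ≤ 1`. -/
def codeLength (w : ℚ) : ℕ := (Int.clog 2 w⁻¹).toNat

/-- The final output for the interval `[l, l + w)`: with `L = ⌈-log₂ w⌉`, the `L` binary digits
(the most significant first) of the least multiple of `2 ^ (-L)` in the interval. -/
def outputBits (I : ℚ × ℚ) : List Bool :=
  (List.range (codeLength I.2)).map fun i =>
    (⌈I.1 * 2 ^ codeLength I.2⌉₊).testBit (codeLength I.2 - 1 - i)

/-- The Bounded PPM compressor with bound `k`. -/
def bounded (k : ℕ) (x : List Bool) : List Bool :=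
  outputBits (encodeFrom (boundedContexts k) [] (0, 1) x)

/-- The PPM* compressor. -/
def star (x : List Bool) : List Bool := outputBits (encodeFrom starContexts [] (0, 1) x)

/-! ### The sequence built from de Bruijn strings -/

/-- `x` is a de Bruijn string of order `n`: it has length `2 ^ n` and, viewed cyclically, contains
every string of length `n` exactly once. -/
def IsDeBruijn (n : ℕ) (x : List Bool) : Prop :=
  x.length = 2 ^ n ∧ ∀ w : List Bool, w.length = n → occ w (x ++ x.take (n - 1)) = 1

open Classical in
/-- The lexicographically least de Bruijn string of order `n`, for `n ≥ 1` (the order on `List Bool`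
is the lexicographic one, with `false < true`). -/
noncomputable def db (n : ℕ) : List Bool :=
  if h : ∃ x, IsLeast {y | IsDeBruijn n y} x then h.choose else []

/-- `B_{n,i}`, where `n = 2 ^ s * t` with `t` odd: the left shift of `db n` by `i` bits, repeated
`t` times. -/
noncomputable def block (n i : ℕ) : List Bool :=
  (List.replicate (n / 2 ^ padicValNat 2 n) ((db n).rotate i)).flatten

/-- `S_n`, the concatenation of `B_{n,0}, …, B_{n,2^s-1}`, where `n = 2 ^ s * t` with `t` odd. -/
noncomputable def zone (n : ℕ) : List Bool :=
  (List.range (2 ^ padicValNat 2 n)).flatMap fun i => block n i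

/-- `S_1 S_2 ⋯ S_n`. -/
noncomputable def zones (n : ℕ) : List Bool :=
  (List.range n).flatMap fun j => zone (j + 1)

/-- The sequence `S = S_1 S_2 S_3 ⋯`.  As `S_1 ⋯ S_{i+1}` has more than `i` bits, its bit
with index `i` (counted from 0) is that of `S`. -/
noncomputable def seqS (i : ℕ) : Bool := (zones (i + 1)).getD i false

end PPM

namespace PPM

/-! Equidistribution. Some de Bruijn string of order n begins with n zeros (a maximal-length linear
recurring sequence with one more zero), hence so does the least one. At each passage between blocks
of `zone n` one bit of the periodic de Bruijn string is skipped. There are at most n blocks, so that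
bit lies in the initial run of zeros, and it does not matter which zero of a run is deleted: after
its first bit, the zone repeats the first block without its first bit and ends in zeros. Counting
positions modulo 2^n, every string of length n begins exactly n times in the zone, and summing over
extensions settles shorter strings (`card_win_zone`). This is the third claim.

Bounded PPM. Each complete zone of order greater than k adds equally to both counts of a context of
length k. The unfinished zone can upset the balance only by a factor of about 2, because the total
length of the zones roughly doubles with each new one. So eventually the bit is encoded at once in
the context of length k, with probability at most 7/10 < 2^(-1/2).

PPM*. In the first n zones a bit costs O(log n): there is at most one escape, and the contexts used
are long enough to have counts polynomial in n (`le_bitWidth_star_seqS`). Nearly all bits cost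
almost nothing, for two reasons. First, for l polynomial in n the roughly n 2^n positions carry only
O(2^n) distinct windows of length l (`card_windows_le`), so all but O(A 2^n) windows have occurred A
times before. Second, the number of distinct windows grows from length l to l + 1 by at least the
number of windows with two continuations. Some l between n and n + n^3 therefore has few of these
(`exists_few_special`), and a window of length at least n occurs at most n(n + 1) times. At all
other positions the last l bits are a deterministic context with count at least A. The shortest
deterministic context is a suffix of it and predicts at least as well, so the probability is at
least 1 - 1/(A + 1). The exceptional bits cost O(A 2^n log n), which is negligible against n 2^n. -/

/-! ### Windows of a sequence -/

/-- The window of length `l` of the sequence `S` that begins at the position `p`. -/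
def win (S : ℕ → Bool) (p l : ℕ) : List Bool := (List.range l).map fun i => S (p + i)

@[simp] theorem length_win (S : ℕ → Bool) (p l : ℕ) : (win S p l).length = l := by simp [win]

@[simp] theorem win_zero (S : ℕ → Bool) (p : ℕ) : win S p 0 = [] := rfl

theorem initSeg_eq_win (S : ℕ → Bool) (n : ℕ) : initSeg S n = win S 0 n := by
  simp [initSeg, win]

theorem win_succ (S : ℕ → Bool) (p l : ℕ) : win S p (l + 1) = win S p l ++ [S (p + l)] := by
  simp [win, List.range_succ]

theorem win_add (S : ℕ → Bool) (p l m : ℕ) :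
    win S p (l + m) = win S p l ++ win S (p + l) m := by
  simp [win, List.range_add, add_assoc, Function.comp_def]

theorem win_cons (S : ℕ → Bool) (p l : ℕ) : win S p (l + 1) = S p :: win S (p + 1) l := by
  rw [add_comm, win_add]; rfl

theorem win_eq_win_iff {S S' : ℕ → Bool} {p p' l : ℕ} :
    win S p l = win S' p' l ↔ ∀ i < l, S (p + i) = S' (p' + i) := by
  simp [win]

theorem win_eq_iff {S : ℕ → Bool} {p l : ℕ} {w : List Bool} (hw : w.length = l) :
    win S p l = w ↔ ∀ (i : ℕ) (h : i < l), S (p + i) = w[i]'(hw ▸ h) := by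
  subst hw
  constructor
  · intro h i hi
    have : (win S p w.length)[i]? = w[i]? := by rw [h]
    simpa [win, hi] using this
  · intro h
    apply List.ext_getElem (by simp)
    intro i h1 h2
    simpa [win] using h i h2

theorem win_prefix {S : ℕ → Bool} {p l m : ℕ} (h : l ≤ m) : win S p l <+: win S p m := by
  obtain ⟨d, rfl⟩ := Nat.exists_eq_add_of_le h
  rw [win_add]; exact List.prefix_append _ _

theorem take_win {S : ℕ → Bool} {p l m : ℕ} (h : l ≤ m) : (win S p m).take l = win S p l := by
  obtain ⟨d, rfl⟩ := Nat.exists_eq_add_of_le h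
  rw [win_add, List.take_left' (by simp)]

theorem win_suffix {S : ℕ → Bool} {p l m : ℕ} (h : l ≤ m) :
    win S (p + (m - l)) l <:+ win S p m := by
  obtain ⟨d, rfl⟩ := Nat.exists_eq_add_of_le' h
  rw [win_add, Nat.add_sub_cancel]; exact List.suffix_append _ _

theorem prefix_win_iff {S : ℕ → Bool} {p m : ℕ} {w : List Bool} :
    w <+: win S p m ↔ w.length ≤ m ∧ win S p w.length = w := by
  constructor
  · intro h
    have hl : w.length ≤ m := by simpa using h.length_le
    exact ⟨hl, by rw [← take_win hl]; exact (List.prefix_iff_eq_take.1 h).symm⟩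
  · rintro ⟨hl, h⟩
    rw [← h]; simpa using win_prefix hl

theorem occ_cons (w : List Bool) (a : Bool) (x : List Bool) :
    occ w (a :: x) = occ w x + if w <+: a :: x then 1 else 0 := by
  simp [occ, List.countP_cons]

theorem occ_win (w : List Bool) (S : ℕ → Bool) (p q : ℕ) :
    occ w (win S p q) =
      ((Finset.range (q + 1 - w.length)).filter fun i => win S (p + i) w.length = w).card := by
  induction q generalizing p with
  | zero =>
    cases w <;> simp [occ]
  | succ q ih =>
    rw [win_cons, occ_cons, ih, ← win_cons]
    by_cases hl : w.length ≤ q + 1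
    · have e : q + 1 + 1 - w.length = (q + 1 - w.length) + 1 := by omega
      rw [e, Finset.card_filter, Finset.card_filter, Finset.sum_range_succ']
      simp [prefix_win_iff, hl, add_assoc, add_comm 1]
    · have e : q + 1 + 1 - w.length = 0 := by omega
      have e' : q + 1 - w.length = 0 := by omega
      simp [e, e', prefix_win_iff, hl]

/-! ### De Bruijn sequences from finite fields -/

/-- There is a generator of the unit group of the field with `2 ^ n` elements, together with a
linear functional that vanishes on its powers with exponent less than `n - 1`. -/
theorem exists_generator_functional (n : ℕ) (hn : n ≠ 0) :
    ∃ (g : (GaloisField 2 n)ˣ) (f : GaloisField 2 n →ₗ[ZMod 2] ZMod 2),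
      orderOf g = 2 ^ n - 1 ∧ (∀ i < n - 1, f ((g : GaloisField 2 n) ^ i) = 0) ∧
      ∀ x : GaloisField 2 n, (∀ i < n, f ((g : GaloisField 2 n) ^ i * x) = 0) → x = 0 := by
  classical
  have : Finite (GaloisField 2 n) := inferInstance
  have : Fintype (GaloisField 2 n) := Fintype.ofFinite _
  obtain ⟨g, hg⟩ := IsCyclic.exists_generator (α := (GaloisField 2 n)ˣ)
  have hord : orderOf g = 2 ^ n - 1 := by
    rw [orderOf_eq_card_of_forall_mem_zpowers hg, Nat.card_units, GaloisField.card 2 n hn]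
  have htop : IntermediateField.adjoin (ZMod 2) {(g : GaloisField 2 n)} = ⊤ := by
    apply eq_top_iff.2
    rintro x -
    by_cases hx : x = 0
    · rw [hx]; exact zero_mem _
    · obtain ⟨m, hm⟩ := Set.mem_range.mp (hg (Units.mk0 x hx))
      rw [show x = (g : GaloisField 2 n) ^ m by norm_cast; rw [hm, Units.val_mk0]]
      exact zpow_mem (IntermediateField.mem_adjoin_simple_self (ZMod 2) (g : GaloisField 2 n)) m
  have hdeg : (minpoly (ZMod 2) (g : GaloisField 2 n)).natDegree = n := by
    rw [(Field.primitive_element_iff_minpoly_natDegree_eq (ZMod 2) _).1 htop,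
      GaloisField.finrank 2 hn]
  have hli := linearIndependent_pow (K := ZMod 2) (g : GaloisField 2 n)
  rw [hdeg] at hli
  have : Nonempty (Fin n) := ⟨⟨0, Nat.pos_of_ne_zero hn⟩⟩
  let B := basisOfLinearIndependentOfCardEqFinrank hli (by
    rw [GaloisField.finrank 2 hn, Fintype.card_fin])
  have hB : ∀ i : Fin n, B i = (g : GaloisField 2 n) ^ (i : ℕ) := fun i => by
    simp [B]
  have hlast : n - 1 < n := by omega
  -- The last coordinate in the basis 1, g, …, g^(n-1).
  let f := B.coord ⟨n - 1, hlast⟩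
  refine ⟨g, f, hord, ?_, ?_⟩
  · intro i hi
    have := hB ⟨i, by omega⟩
    simp only at this
    rw [← this]
    simp only [f, Module.Basis.coord_apply, Module.Basis.repr_self]
    rw [Finsupp.single_apply, if_neg]
    intro h
    have := congrArg Fin.val h
    simp at this
    omega
  · intro x hx
    by_contra hx0
    -- The functional y ↦ f(yx) vanishes on a basis; for x ≠ 0 this contradicts its value 1 at y =
    -- g^(n-1) x⁻¹.
    have hz : f ∘ₗ LinearMap.mulRight (ZMod 2) x = 0 := by
      apply B.ext
      intro i
      rw [LinearMap.comp_apply, LinearMap.mulRight_apply, hB]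
      simpa using hx i i.2
    have h1 := LinearMap.congr_fun hz (B ⟨n - 1, hlast⟩ * x⁻¹)
    rw [LinearMap.comp_apply, LinearMap.mulRight_apply, mul_assoc, inv_mul_cancel₀ hx0, mul_one]
      at h1
    simp [f] at h1

/-- A binary sequence with period `2 ^ n - 1` whose windows of length `n` within a period are
distinct and nonzero. -/
theorem exists_maxLength_sequence (n : ℕ) (hn : n ≠ 0) :
    ∃ a : ℕ → Bool, (∀ i, a (i + (2 ^ n - 1)) = a i) ∧ (∀ i < n - 1, a i = false) ∧
      (∀ i, win a i n ≠ List.replicate n false) ∧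
      ∀ i < 2 ^ n - 1, ∀ j < 2 ^ n - 1, win a i n = win a j n → i = j := by
  obtain ⟨g, f, hord, hf0, hf⟩ := exists_generator_functional n hn
  have key : ∀ u v : ZMod 2, decide (u ≠ 0) = decide (v ≠ 0) → u = v := by decide
  -- The window at i consists of the values f(g^l g^i), which determine g^i.
  refine ⟨fun i => decide (f ((g : GaloisField 2 n) ^ i) ≠ 0), ?_, ?_, ?_, ?_⟩
  · intro i
    have : (g : GaloisField 2 n) ^ (2 ^ n - 1) = 1 := by
      rw [← hord]; norm_cast; rw [pow_orderOf_eq_one, Units.val_one]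
    simp [pow_add, this]
  · intro i hi
    simp [hf0 i hi]
  · intro i h
    rw [win_eq_iff (by simp)] at h
    have := hf ((g : GaloisField 2 n) ^ i) (fun l hl => by
      have := h l hl
      rw [← pow_add, add_comm l i]
      simpa using this)
    exact pow_ne_zero i g.ne_zero this
  · intro i hi j hj h
    rw [win_eq_win_iff] at h
    have := hf ((g : GaloisField 2 n) ^ i - (g : GaloisField 2 n) ^ j) (fun l hl => by
      have := key _ _ (h l hl)
      rw [mul_sub, ← pow_add, ← pow_add, add_comm l i, add_comm l j, map_sub, this, sub_self])
    have h2 : g ^ i = g ^ j := by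
      ext
      push_cast
      exact sub_eq_zero.1 this
    exact pow_injOn_Iio_orderOf (by simpa [hord] using hi) (by simpa [hord] using hj) h2

/-- A periodic binary sequence that runs through a de Bruijn string of order `n` that begins with
`n` zeros. -/
theorem exists_deBruijn_sequence (n : ℕ) (hn : n ≠ 0) :
    ∃ D : ℕ → Bool, (∀ p, D (p + 2 ^ n) = D p) ∧ (∀ i < n, D i = false) ∧
      ∀ p < 2 ^ n, ∀ q < 2 ^ n, win D p n = win D q n → p = q := by
  obtain ⟨a, hper, h0, hne, hinj⟩ := exists_maxLength_sequence n hn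
  have hN : n < 2 ^ n := Nat.lt_two_pow_self
  set N := 2 ^ n with hNdef
  -- One zero put before the n - 1 initial zeros supplies the missing zero window and leaves the
  -- other windows unchanged.
  let D : ℕ → Bool := fun p => if p % N = 0 then false else a (p % N - 1)
  have hD0 : ∀ i < n, D i = false := by
    intro i hi
    simp only [D]
    rw [Nat.mod_eq_of_lt (by omega)]
    split_ifs
    · rfl
    · exact h0 _ (by omega)
  have hDp : ∀ p, D (p + N) = D p := fun p => by simp [D]
  have hwin : ∀ r, 1 ≤ r → r < N → win D r n = win a (r - 1) n := by
    intro r h1 h2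
    rw [win_eq_win_iff]
    intro i hi
    by_cases h : r + i < N
    · simp only [D]
      rw [Nat.mod_eq_of_lt h, if_neg (by omega)]
      congr 1; omega
    -- A window that wraps around continues into the initial zeros of both sequences.
    · obtain ⟨e, he⟩ := Nat.exists_eq_add_of_le' (not_lt.1 h)
      have e2 : r - 1 + i = e + (N - 1) := by omega
      rw [he, hDp, e2, hper, hD0 _ (by omega), h0 _ (by omega)]
  have hwin0 : win D 0 n = List.replicate n false := by
    rw [win_eq_iff (by simp)]
    intro i hi
    simpa using hD0 i hi
  refine ⟨D, hDp, hD0, ?_⟩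
  intro p hp q hq h
  rcases Nat.eq_zero_or_pos p with rfl | hp0
  · rcases Nat.eq_zero_or_pos q with rfl | hq0
    · rfl
    · rw [hwin0, hwin q hq0 hq] at h
      exact absurd h.symm (hne _)
  · rcases Nat.eq_zero_or_pos q with rfl | hq0
    · rw [hwin0, hwin p hp0 hp] at h
      exact absurd h (hne _)
    · rw [hwin p hp0 hp, hwin q hq0 hq] at h
      have := hinj (p - 1) (by omega) (q - 1) (by omega) h
      omega

/-- By periodicity, appending the first n - 1 bits gives a longer window of D, so cyclic occurrences
are positions below 2^n. -/
theorem isDeBruijn_win_iff {D : ℕ → Bool} {n : ℕ} (hn : n ≠ 0) (hper : ∀ p, D (p + 2 ^ n) = D p) :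
    IsDeBruijn n (win D 0 (2 ^ n)) ↔ ∀ w : List Bool, w.length = n →
      ((Finset.range (2 ^ n)).filter fun p => win D p n = w).card = 1 := by
  have hN : n < 2 ^ n := Nat.lt_two_pow_self
  have e : win D 0 (2 ^ n) ++ (win D 0 (2 ^ n)).take (n - 1) = win D 0 (2 ^ n + (n - 1)) := by
    rw [take_win (by omega), win_add]
    congr 1
    rw [win_eq_win_iff]
    intro i _
    rw [zero_add, zero_add, add_comm, hper]
  have e2 : ∀ w : List Bool, w.length = n →
      occ w (win D 0 (2 ^ n + (n - 1))) =
        ((Finset.range (2 ^ n)).filter fun p => win D p n = w).card := by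
    intro w hw
    rw [occ_win, hw]
    rw [show 2 ^ n + (n - 1) + 1 - n = 2 ^ n by omega]
    simp
  unfold IsDeBruijn
  rw [e]
  simp only [length_win, true_and]
  exact forall₂_congr fun w hw => by rw [e2 w hw]

/-- The windows of length `n` at `2 ^ n` positions are distinct if and only if each string of
length `n` is one of them exactly once. -/
theorem win_injOn_iff_card {D : ℕ → Bool} {n : ℕ} :
    (∀ p < 2 ^ n, ∀ q < 2 ^ n, win D p n = win D q n → p = q) ↔
      ∀ w : List Bool, w.length = n →
        ((Finset.range (2 ^ n)).filter fun p => win D p n = w).card = 1 := by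
  constructor
  · intro hinj w hw
    let F : Fin (2 ^ n) → List.Vector Bool n := fun p => ⟨win D p n, by simp⟩
    have hF : Function.Injective F := by
      intro p q h
      exact Fin.ext (hinj p p.2 q q.2 (congrArg Subtype.val h))
    have hS : Function.Surjective F :=
      ((Fintype.bijective_iff_injective_and_card F).2 ⟨hF, by simp⟩).2
    obtain ⟨p, hp⟩ := hS ⟨w, hw⟩
    have hp' : win D p n = w := congrArg Subtype.val hp
    rw [Finset.card_eq_one]
    refine ⟨p, ?_⟩
    ext q
    simp only [Finset.mem_filter, Finset.mem_range, Finset.mem_singleton]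
    constructor
    · rintro ⟨hq, h⟩
      exact hinj q hq p p.2 (h.trans hp'.symm)
    · rintro rfl
      exact ⟨p.2, hp'⟩
  · intro h p hp q hq hpq
    obtain ⟨r, hr⟩ := Finset.card_eq_one.1 (h (win D q n) (by simp))
    have h1 : p ∈ ({r} : Finset ℕ) := by rw [← hr]; simp [hp, hpq]
    have h2 : q ∈ ({r} : Finset ℕ) := by rw [← hr]; simp [hq]
    rw [Finset.mem_singleton] at h1 h2
    rw [h1, h2]

/-! ### The least de Bruijn string -/

/-- There are finitely many de Bruijn strings and at least one, so the default value in `db` is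
never taken. -/
theorem isLeast_db (n : ℕ) (hn : n ≠ 0) : IsLeast {y | IsDeBruijn n y} (db n) := by
  have hfin : {y | IsDeBruijn n y}.Finite :=
    (List.finite_length_eq Bool (2 ^ n)).subset fun y hy => hy.1
  obtain ⟨D, hper, _, hinj⟩ := exists_deBruijn_sequence n hn
  have hne : {y | IsDeBruijn n y}.Nonempty :=
    ⟨_, (isDeBruijn_win_iff hn hper).2 (win_injOn_iff_card.1 hinj)⟩
  obtain ⟨x, hx, hmin⟩ := Set.exists_min_image _ id hfin hne
  have h : ∃ x, IsLeast {y | IsDeBruijn n y} x := ⟨x, hx, fun y hy => hmin y hy⟩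
  rw [db, dif_pos h]
  exact h.choose_spec

/-- The periodic continuation of `db n`. -/
noncomputable def dbSeq (n p : ℕ) : Bool := (db n).getD (p % 2 ^ n) false

theorem length_db {n : ℕ} (hn : n ≠ 0) : (db n).length = 2 ^ n := (isLeast_db n hn).1.1

theorem dbSeq_add (n p : ℕ) : dbSeq n (p + 2 ^ n) = dbSeq n p := by simp [dbSeq]

theorem dbSeq_mod (n p : ℕ) : dbSeq n (p % 2 ^ n) = dbSeq n p := by simp [dbSeq]

theorem dbSeq_add_mul (n p k : ℕ) : dbSeq n (p + k * 2 ^ n) = dbSeq n p := by simp [dbSeq]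

theorem db_eq_win {n : ℕ} (hn : n ≠ 0) : db n = win (dbSeq n) 0 (2 ^ n) := by
  symm
  rw [win_eq_iff (length_db hn)]
  intro i hi
  have := length_db hn
  simp [dbSeq, Nat.mod_eq_of_lt hi, this, hi]

theorem dbSeq_win_inj {n : ℕ} (hn : n ≠ 0) {p q : ℕ} (hp : p < 2 ^ n) (hq : q < 2 ^ n)
    (h : win (dbSeq n) p n = win (dbSeq n) q n) : p = q := by
  have h1 : IsDeBruijn n (db n) := (isLeast_db n hn).1
  rw [db_eq_win hn, isDeBruijn_win_iff hn (dbSeq_add n), ← win_injOn_iff_card] at h1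
  exact h1 p hp q hq h

/-- A string that is lexicographically at most a string beginning with zeros begins with as many
zeros, if it is long enough. -/
theorem getElem_eq_false_of_le {x y : List Bool} (h : x ≤ y) {k : ℕ}
    (hy : ∀ i < k, y[i]? = some false) (hx : k ≤ x.length) : ∀ i < k, x[i]? = some false := by
  induction k generalizing x y with
  | zero => simp
  | succ k ih =>
    cases x with
    | nil => simp at hx
    | cons a x =>
      cases y with
      | nil => simpa using hy 0 (by omega)
      | cons b y =>
        have hb : b = false := by simpa using hy 0 (by omega)
        subst hb
        have ha : a = false ∧ x ≤ y := by
          rw [← not_lt, List.cons_lt_cons_iff] at h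
          cases a <;> simp_all
        obtain ⟨rfl, hxy⟩ := ha
        · intro i hi
          cases i with
          | zero => simp
          | succ i =>
            simpa using ih hxy (fun j hj => by simpa using hy (j + 1) (by omega))
              (by simpa using hx) i (by omega)

/-- The least de Bruijn string is at most the constructed one, which begins with n zeros. -/
theorem dbSeq_eq_false {n i : ℕ} (hi : i < n) : dbSeq n i = false := by
  have hn : n ≠ 0 := by omega
  have hN : n < 2 ^ n := Nat.lt_two_pow_self
  obtain ⟨D, hper, h0, hinj⟩ := exists_deBruijn_sequence n hn
  have hle := (isLeast_db n hn).2 ((isDeBruijn_win_iff hn hper).2 (win_injOn_iff_card.1 hinj))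
  have := getElem_eq_false_of_le hle (k := n) (fun j hj => by
    have : j < 2 ^ n := by omega
    simp [win, this, h0 j hj]) (by rw [length_db hn]; omega) i hi
  simp [dbSeq, Nat.mod_eq_of_lt (hi.trans hN), this]

/-! ### The layout of a zone -/

/-- The number of blocks of `zone n`. -/
def numBlocks (n : ℕ) : ℕ := 2 ^ padicValNat 2 n

/-- The length of the blocks of `zone n`. -/
def blockLen (n : ℕ) : ℕ := n / numBlocks n * 2 ^ n

/-- The position at which `zone n` begins in the sequence. -/
def zoneStart (n : ℕ) : ℕ := ∑ j ∈ Finset.range n, j * 2 ^ j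

theorem zoneStart_succ (n : ℕ) : zoneStart (n + 1) = zoneStart n + n * 2 ^ n := by
  simp [zoneStart, Finset.sum_range_succ]

theorem zoneStart_mono : Monotone zoneStart := fun _ _ h =>
  Finset.sum_le_sum_of_subset (by simpa using h)

theorem numBlocks_mul {n : ℕ} : numBlocks n * (n / numBlocks n) = n :=
  Nat.mul_div_cancel' pow_padicValNat_dvd

theorem numBlocks_le {n : ℕ} (hn : n ≠ 0) : numBlocks n ≤ n :=
  Nat.le_of_dvd (Nat.pos_of_ne_zero hn) pow_padicValNat_dvd

theorem numBlocks_pos (n : ℕ) : 0 < numBlocks n := by simp [numBlocks]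

theorem numBlocks_mul_blockLen (n : ℕ) : numBlocks n * blockLen n = n * 2 ^ n := by
  rw [blockLen, ← mul_assoc, numBlocks_mul]

theorem two_pow_le_blockLen {n : ℕ} (hn : n ≠ 0) : 2 ^ n ≤ blockLen n :=
  Nat.le_mul_of_pos_left _ (Nat.div_pos (numBlocks_le hn) (numBlocks_pos n))

theorem rotate_db {n : ℕ} (hn : n ≠ 0) (i : ℕ) :
    (db n).rotate i = win (dbSeq n) i (2 ^ n) := by
  symm
  rw [win_eq_iff (by simp [length_db hn])]
  intro j hj
  have hlt : (i + j) % 2 ^ n < (db n).length := by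
    rw [length_db hn]; exact Nat.mod_lt _ (by positivity)
  rw [List.getElem_rotate, dbSeq, List.getD_eq_getElem _ _ hlt]
  simp [length_db hn, add_comm]

theorem block_eq_win {n : ℕ} (hn : n ≠ 0) (i : ℕ) :
    block n i = win (dbSeq n) i (blockLen n) := by
  have key : ∀ t : ℕ, (List.replicate t (win (dbSeq n) i (2 ^ n))).flatten =
      win (dbSeq n) i (t * 2 ^ n) := by
    intro t
    induction t with
    | zero => simp
    | succ t ih =>
      rw [List.replicate_succ, List.flatten_cons, ih, Nat.succ_mul, add_comm (t * 2 ^ n), win_add]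
      congr 1
      rw [win_eq_win_iff]
      intro j _
      rw [show i + 2 ^ n + j = i + j + 2 ^ n by ring, dbSeq_add]
  rw [block, rotate_db hn, key]; rfl

/-- Every block passed advances the de Bruijn position by one extra step, whence the summand `r /
blockLen n`. -/
theorem zone_eq_win {n : ℕ} (hn : n ≠ 0) :
    zone n = win (fun r => dbSeq n (r + r / blockLen n)) 0 (n * 2 ^ n) := by
  have hB : 0 < blockLen n := lt_of_lt_of_le (by positivity) (two_pow_le_blockLen hn)
  have key : ∀ m : ℕ, ((List.range m).flatMap fun i => block n i) =
      win (fun r => dbSeq n (r + r / blockLen n)) 0 (m * blockLen n) := by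
    intro m
    induction m with
    | zero => simp
    | succ m ih =>
      rw [List.range_succ, List.flatMap_append, ih, Nat.succ_mul, win_add]
      congr 1
      rw [List.flatMap_singleton, block_eq_win hn, win_eq_win_iff]
      intro j hj
      have e : (0 + m * blockLen n + j) / blockLen n = m := by
        rw [zero_add, add_comm, Nat.add_mul_div_right _ _ hB, Nat.div_eq_of_lt hj, zero_add]
      rw [e, blockLen, show 0 + m * (n / numBlocks n * 2 ^ n) + j + m =
        m + j + (m * (n / numBlocks n)) * 2 ^ n by ring, dbSeq_add_mul]
  rw [← numBlocks_mul_blockLen, ← key]; rfl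

theorem length_zone {n : ℕ} (hn : n ≠ 0) : (zone n).length = n * 2 ^ n := by
  rw [zone_eq_win hn, length_win]

theorem zones_succ (n : ℕ) : zones (n + 1) = zones n ++ zone (n + 1) := by
  simp [zones, List.range_succ]

theorem length_zones (n : ℕ) : (zones n).length = zoneStart (n + 1) := by
  induction n with
  | zero => simp [zones, zoneStart]
  | succ n ih => rw [zones_succ, List.length_append, ih, length_zone (by omega), ← zoneStart_succ]

theorem zones_prefix {m n : ℕ} (h : m ≤ n) : zones m <+: zones n := by
  induction n, h using Nat.le_induction with
  | base => exact List.prefix_refl _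
  | succ n _ ih => rw [zones_succ]; exact ih.trans (List.prefix_append _ _)

theorem seqS_eq_getElem {m i : ℕ} (h : i < (zones m).length) : seqS i = (zones m)[i] := by
  have hi : i < (zones (i + 1)).length := by
    rw [length_zones, zoneStart_succ]
    have : (i + 1) * 1 ≤ (i + 1) * 2 ^ (i + 1) := Nat.mul_le_mul_left _ Nat.one_le_two_pow
    omega
  rw [seqS, List.getD_eq_getElem _ _ hi]
  rcases le_total m (i + 1) with h' | h'
  · exact ((zones_prefix h').getElem h).symm
  · exact (zones_prefix h').getElem hi

theorem win_seqS_zone {n : ℕ} (hn : n ≠ 0) : win seqS (zoneStart n) (n * 2 ^ n) = zone n := by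
  rw [win_eq_iff (length_zone hn)]
  intro i hi
  obtain ⟨m, rfl⟩ := Nat.exists_eq_succ_of_ne_zero hn
  have hl := length_zones m
  have h : zoneStart (m + 1) + i < (zones (m + 1)).length := by
    rw [length_zones, zoneStart_succ (m + 1)]; simpa using hi
  rw [seqS_eq_getElem h]
  simp only [zones_succ]
  rw [List.getElem_append_right (by simp [hl])]
  simp [hl]

theorem seqS_zone {n r : ℕ} (hn : n ≠ 0) (hr : r < n * 2 ^ n) :
    seqS (zoneStart n + r) = dbSeq n (r + r / blockLen n) := by
  have h := win_seqS_zone hn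
  rw [zone_eq_win hn, win_eq_win_iff] at h
  simpa using h r hr

/-- The bits of `zone n` other than the first and the last ones run periodically through the first
block without its first bit. -/
theorem seqS_zone_mid {n x : ℕ} (hn : n ≠ 0) (hx : x < numBlocks n * (blockLen n - 1)) :
    seqS (zoneStart n + (x + 1)) = dbSeq n (x % (blockLen n - 1) + 1) := by
  have hN : n < 2 ^ n := Nat.lt_two_pow_self
  have hB := two_pow_le_blockLen hn
  have hs := numBlocks_le hn
  have htot := numBlocks_mul_blockLen n
  have hB1 : 0 < blockLen n - 1 := by omega
  set i := x / (blockLen n - 1) with hi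
  set o := x % (blockLen n - 1) with ho
  have hx' : x = i * (blockLen n - 1) + o := (Nat.div_add_mod' x _).symm
  have hi' : i < numBlocks n := by
    rw [hi, Nat.div_lt_iff_lt_mul hB1]; exact hx
  have ho' : o < blockLen n - 1 := Nat.mod_lt _ hB1
  clear_value i o
  have hiB : i * (blockLen n - 1) + i = i * blockLen n := by
    conv_rhs => rw [show blockLen n = blockLen n - 1 + 1 by omega]
    ring
  have hsB : (i + 1) * blockLen n ≤ numBlocks n * blockLen n := Nat.mul_le_mul_right _ hi'
  rw [Nat.succ_mul] at hsB
  have hlt : x + 1 < n * 2 ^ n := by omega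
  rw [seqS_zone hn hlt]
  -- Periods are one shorter than blocks, so the start of period i drifts back into block i - 1.
  -- There the two sides read bits o and o + 1 of the initial run of zeros.
  by_cases hc : i ≤ o + 1
  · have e1 : x + 1 = i * blockLen n + (o + 1 - i) := by omega
    have e2 : (x + 1) / blockLen n = i := by
      rw [e1, add_comm, Nat.add_mul_div_right _ _ (by omega), Nat.div_eq_of_lt (by omega), zero_add]
    rw [e2, e1, show i * blockLen n + (o + 1 - i) + i = o + 1 + i * blockLen n by omega, blockLen,
      ← mul_assoc, dbSeq_add_mul]
  · obtain ⟨i', rfl'⟩ : ∃ i', i = i' + 1 := ⟨i - 1, by omega⟩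
    have e0 : i * blockLen n = i' * blockLen n + blockLen n := by rw [rfl', Nat.succ_mul]
    have e1 : x + 1 = i' * blockLen n + (blockLen n + o - i') := by omega
    have e2 : (x + 1) / blockLen n = i' := by
      rw [e1, add_comm, Nat.add_mul_div_right _ _ (by omega), Nat.div_eq_of_lt (by omega), zero_add]
    rw [e2, show x + 1 + i' = o + i * blockLen n by omega, blockLen, ← mul_assoc, dbSeq_add_mul,
      dbSeq_eq_false (by omega), dbSeq_eq_false (by omega)]

/-- The last block is rotated by `numBlocks n - 1` and so ends in that many initial zeros; the next
zone begins with n + 1 zeros. -/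
theorem seqS_zone_end {n x : ℕ} (hn : n ≠ 0) (h1 : numBlocks n * (blockLen n - 1) < x)
    (h2 : x ≤ n * 2 ^ n + n) : seqS (zoneStart n + x) = false := by
  have hN : n < 2 ^ n := Nat.lt_two_pow_self
  have hB := two_pow_le_blockLen hn
  have hs := numBlocks_le hn
  have hs0 := numBlocks_pos n
  have htot := numBlocks_mul_blockLen n
  by_cases hlt : x < n * 2 ^ n
  · rw [seqS_zone hn hlt]
    obtain ⟨i, hi⟩ : ∃ i, numBlocks n = i + 1 := ⟨numBlocks n - 1, by omega⟩
    have e0 : numBlocks n * (blockLen n - 1) + numBlocks n = numBlocks n * blockLen n := by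
      conv_rhs => rw [show blockLen n = blockLen n - 1 + 1 by omega]
      ring
    have e1 : numBlocks n * blockLen n = i * blockLen n + blockLen n := by rw [hi, Nat.succ_mul]
    have e2 : x / blockLen n = i := by
      rw [show x = (x - i * blockLen n) + i * blockLen n by omega,
        Nat.add_mul_div_right _ _ (by omega), Nat.div_eq_of_lt (by omega), zero_add]
    rw [e2, show x + i = (x + i - numBlocks n * blockLen n) + n * 2 ^ n by omega, dbSeq_add_mul,
      dbSeq_eq_false (by omega)]
  · rw [show zoneStart n + x = zoneStart (n + 1) + (x - n * 2 ^ n) by rw [zoneStart_succ]; omega]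
    have hle : (n + 1) * 1 ≤ (n + 1) * 2 ^ (n + 1) := Nat.mul_le_mul_left _ Nat.one_le_two_pow
    have hB' := two_pow_le_blockLen (n := n + 1) (by omega)
    have hN' : n + 1 < 2 ^ (n + 1) := Nat.lt_two_pow_self
    rw [seqS_zone (by omega) (by omega), Nat.div_eq_of_lt (by omega), dbSeq_eq_false (by omega)]

/-- The position in the de Bruijn string of the window of length `n` that begins in `zone n` with
offset `r`. -/
def zonePos (n r : ℕ) : ℕ :=
  if 0 < r ∧ r ≤ numBlocks n * (blockLen n - 1) then (r - 1) % (blockLen n - 1) + 1 else 0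

theorem win_zone {n r : ℕ} (hn : n ≠ 0) (hr : r < n * 2 ^ n) :
    win seqS (zoneStart n + r) n = win (dbSeq n) (zonePos n r) n := by
  have hN : n < 2 ^ n := Nat.lt_two_pow_self
  have hB := two_pow_le_blockLen hn
  have hB1 : 0 < blockLen n - 1 := by omega
  have hle : (n : ℕ) * 1 ≤ n * 2 ^ n := Nat.mul_le_mul_left _ Nat.one_le_two_pow
  have h0 : seqS (zoneStart n) = false := by
    have := seqS_zone hn (r := 0) (by omega)
    simpa [dbSeq_eq_false (Nat.pos_of_ne_zero hn)] using this
  have hs0 := numBlocks_pos n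
  have hM : blockLen n - 1 ≤ numBlocks n * (blockLen n - 1) := Nat.le_mul_of_pos_left _ hs0
  rw [win_eq_win_iff]
  intro l hl
  unfold zonePos
  split_ifs with h
  · obtain ⟨x, rfl⟩ : ∃ x, r = x + 1 := ⟨r - 1, by omega⟩
    rw [Nat.add_sub_cancel]
    set o := x % (blockLen n - 1) with ho
    have ho' : o < blockLen n - 1 := Nat.mod_lt _ hB1
    set i := x / (blockLen n - 1) with hi
    have hx' : x = i * (blockLen n - 1) + o := (Nat.div_add_mod' x _).symm
    have hi' : i + 1 ≤ numBlocks n := by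
      have : i < numBlocks n := by rw [hi, Nat.div_lt_iff_lt_mul hB1]; omega
      exact this
    have hiM : (i + 1) * (blockLen n - 1) ≤ numBlocks n * (blockLen n - 1) :=
      Nat.mul_le_mul_right _ hi'
    have hiM' : (i + 1) * (blockLen n - 1) = i * (blockLen n - 1) + (blockLen n - 1) :=
      Nat.succ_mul _ _
    by_cases hc : o + l < blockLen n - 1
    · rw [add_assoc, show x + 1 + l = (x + l) + 1 by omega, seqS_zone_mid hn (by omega)]
      congr 1
      rw [show x + l = (o + l) + i * (blockLen n - 1) by omega, Nat.add_mul_mod_self_right,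
        Nat.mod_eq_of_lt hc]
      omega
    -- The window runs past the end of the period, and zeros follow on both sides.
    · have hright : dbSeq n (o + 1 + l) = false := by
        rw [show o + 1 + l = (o + 1 + l - blockLen n) + blockLen n by omega, blockLen,
          dbSeq_add_mul, dbSeq_eq_false]
        rw [← blockLen]; omega
      rw [hright, add_assoc]
      by_cases hc2 : x + l < numBlocks n * (blockLen n - 1)
      · rw [show x + 1 + l = (x + l) + 1 by omega, seqS_zone_mid hn hc2,
          show x + l = (o + l - (blockLen n - 1)) + (i + 1) * (blockLen n - 1) by omega,
          Nat.add_mul_mod_self_right, Nat.mod_eq_of_lt (by omega), dbSeq_eq_false (by omega)]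
      · exact seqS_zone_end hn (by omega) (by omega)
  · rw [zero_add, dbSeq_eq_false hl, add_assoc]
    by_cases hr0 : r = 0
    · subst hr0
      rw [zero_add]
      cases l with
      | zero => simpa using h0
      | succ l =>
        rw [seqS_zone_mid hn (by omega), Nat.mod_eq_of_lt (by omega), dbSeq_eq_false (by omega)]
    · exact seqS_zone_end hn (by omega) (by omega)

/-! ### Equidistribution in a zone -/

theorem sum_range_mul_mod (f : ℕ → ℕ) (a b : ℕ) :
    ∑ x ∈ Finset.range (a * b), f (x % b) = a * ∑ x ∈ Finset.range b, f x := by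
  induction a with
  | zero => simp
  | succ a ih =>
    rw [Nat.succ_mul, Finset.sum_range_add, ih, Nat.succ_mul]
    congr 1
    refine Finset.sum_congr rfl fun x hx => ?_
    rw [add_comm, Nat.add_mul_mod_self_right, Nat.mod_eq_of_lt (Finset.mem_range.1 hx)]

/-- In one period every nonzero residue occurs `n / numBlocks n` times and 0 once less. The first
offset and the last `numBlocks n - 1` ones make up for the missing zeros. -/
theorem card_zonePos {n c : ℕ} (hn : n ≠ 0) (hc : c < 2 ^ n) :
    ((Finset.range (n * 2 ^ n)).filter fun r => zonePos n r % 2 ^ n = c).card = n := by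
  have hN : n < 2 ^ n := Nat.lt_two_pow_self
  have hB := two_pow_le_blockLen hn
  have hs0 := numBlocks_pos n
  have htot := numBlocks_mul_blockLen n
  set b : ℕ := if 0 = c then 1 else 0 with hb
  have e0 : numBlocks n * (blockLen n - 1) + numBlocks n = numBlocks n * blockLen n := by
    conv_rhs => rw [show blockLen n = blockLen n - 1 + 1 by omega]
    ring
  have e1 : n * 2 ^ n = (numBlocks n * (blockLen n - 1) + 1) + (numBlocks n - 1) := by omega
  have h1 : ∀ t : ℕ, ∑ x ∈ Finset.range (t * 2 ^ n), (if x % 2 ^ n = c then 1 else 0) = t := by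
    intro t
    rw [sum_range_mul_mod (fun x => if x = c then 1 else 0)]
    simp [hc]
  have h2 : ∑ o ∈ Finset.range (blockLen n - 1), (if (o + 1) % 2 ^ n = c then 1 else 0) + b
      = n / numBlocks n := by
    rw [← h1 (n / numBlocks n), ← blockLen]
    conv_rhs => rw [show blockLen n = blockLen n - 1 + 1 by omega, Finset.sum_range_succ']
    rw [hb]
    congr 1
  rw [Finset.card_filter, e1, Finset.sum_range_add, Finset.sum_range_succ']
  have h3 : ∑ x ∈ Finset.range (numBlocks n * (blockLen n - 1)),
      (if zonePos n (x + 1) % 2 ^ n = c then 1 else 0) = numBlocks n *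
        ∑ o ∈ Finset.range (blockLen n - 1), (if (o + 1) % 2 ^ n = c then 1 else 0) := by
    rw [← sum_range_mul_mod (fun o => if (o + 1) % 2 ^ n = c then 1 else 0)]
    refine Finset.sum_congr rfl fun x hx => ?_
    rw [Finset.mem_range] at hx
    have : zonePos n (x + 1) = x % (blockLen n - 1) + 1 := by
      rw [zonePos, if_pos (by omega), Nat.add_sub_cancel]
    rw [this]
  have h4 : ∑ x ∈ Finset.range (numBlocks n - 1), (if zonePos n
      (numBlocks n * (blockLen n - 1) + 1 + x) % 2 ^ n = c then 1 else 0) =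
        (numBlocks n - 1) * b := by
    rw [Finset.sum_congr rfl (g := fun _ => b)]
    · simp
    · intro x _
      have : zonePos n (numBlocks n * (blockLen n - 1) + 1 + x) = 0 := by
        rw [zonePos, if_neg (by omega)]
      rw [this, Nat.zero_mod]
  rw [h3, h4]
  have h5 : zonePos n 0 = 0 := by simp [zonePos]
  rw [h5, Nat.zero_mod, ← hb]
  calc _ = numBlocks n * (∑ o ∈ Finset.range (blockLen n - 1),
        (if (o + 1) % 2 ^ n = c then 1 else 0)) + (numBlocks n - 1 + 1) * b := by ring
    _ = numBlocks n * (∑ o ∈ Finset.range (blockLen n - 1),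
        (if (o + 1) % 2 ^ n = c then 1 else 0) + b) := by
      rw [Nat.sub_add_cancel hs0]; ring
    _ = n := by rw [h2, numBlocks_mul]

/-- Each string of length at most `n` occurs equally often at the positions of `zone n`. -/
theorem card_win_zone {n : ℕ} (hn : n ≠ 0) (w : List Bool) (hw : w.length ≤ n) :
    ((Finset.range (n * 2 ^ n)).filter fun r => win seqS (zoneStart n + r) w.length = w).card =
      n * 2 ^ (n - w.length) := by
  obtain ⟨d, hd⟩ := Nat.exists_eq_add_of_le hw
  induction d generalizing w with
  | zero =>
    have hwn : w.length = n := by omega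
    obtain ⟨c, hc⟩ := Finset.card_eq_one.1
      (win_injOn_iff_card.1 (fun p hp q hq => dbSeq_win_inj hn hp hq) w hwn)
    have hc' : c ∈ ({c} : Finset ℕ) := Finset.mem_singleton_self c
    rw [← hc, Finset.mem_filter, Finset.mem_range] at hc'
    rw [hwn, Nat.sub_self, pow_zero, mul_one]
    refine Eq.trans (congrArg Finset.card ?_) (card_zonePos hn hc'.1)
    apply Finset.filter_congr
    intro r hr
    rw [win_zone hn (Finset.mem_range.1 hr), ← hc'.2]
    have hmod : win (dbSeq n) (zonePos n r) n = win (dbSeq n) (zonePos n r % 2 ^ n) n := by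
      rw [win_eq_win_iff]
      intro i _
      rw [← dbSeq_mod n (zonePos n r + i), ← dbSeq_mod n (zonePos n r % 2 ^ n + i),
        Nat.mod_add_mod]
    rw [hmod]
    constructor
    · exact dbSeq_win_inj hn (Nat.mod_lt _ (by positivity)) hc'.1
    · intro h; rw [h]
  | succ d ih =>
    -- Each occurrence extends by exactly one of the two bits.
    have key : ∀ r, (if win seqS (zoneStart n + r) w.length = w then 1 else 0) =
        (if win seqS (zoneStart n + r) (w ++ [false]).length = w ++ [false] then 1 else 0) +
        (if win seqS (zoneStart n + r) (w ++ [true]).length = w ++ [true] then 1 else 0) := by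
      intro r
      simp only [List.length_append, List.length_singleton, win_succ]
      cases seqS (zoneStart n + r + w.length) <;> simp
    have h := fun b => ih (w ++ [b]) (by simp; omega) (by simp; omega)
    simp only [Finset.card_filter] at h ⊢
    rw [Finset.sum_congr rfl (fun r _ => key r), Finset.sum_add_distrib, h, h]
    simp only [List.length_append, List.length_singleton]
    rw [show n - w.length = (n - (w.length + 1)) + 1 by omega, pow_succ]
    ring

theorem occ_zone {n : ℕ} (w : List Bool) (h0 : w ≠ []) (hw : w.length ≤ n) :
    occ w (zone n ++ (zone (n + 1)).take (w.length - 1)) = n * 2 ^ (n - w.length) := by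
  have hl : 0 < w.length := List.length_pos_iff.2 h0
  have hn : n ≠ 0 := by omega
  have hle : (n + 1) * 1 ≤ (n + 1) * 2 ^ (n + 1) := Nat.mul_le_mul_left _ Nat.one_le_two_pow
  rw [← win_seqS_zone hn, ← win_seqS_zone (n := n + 1) (by omega), take_win (by omega),
    zoneStart_succ, ← win_add, occ_win, ← card_win_zone hn w hw,
    show n * 2 ^ n + (w.length - 1) + 1 - w.length = n * 2 ^ n by omega]

/-! ### Interval widths -/

/-- The width of the interval that results from transmitting symbols with the given intervals. -/
def width (l : List (ℚ × ℚ)) : ℚ := (l.map Prod.snd).prod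

theorem snd_foldl_narrow (l : List (ℚ × ℚ)) (I : ℚ × ℚ) :
    (l.foldl narrow I).2 = I.2 * width l := by
  induction l generalizing I with
  | nil => simp [width]
  | cons J l ih => simp [ih, narrow, width, mul_assoc]

/-- The factor by which the interval narrows when the bit with index `q` of `S` is encoded. -/
def bitWidth (ctxs : List Bool → List (List Bool)) (S : ℕ → Bool) (q : ℕ) : ℚ :=
  width (encodeBit (win S 0 q) (S q) (ctxs (win S 0 q)))

theorem snd_encodeFrom_win (ctxs : List Bool → List (List Bool)) (S : ℕ → Bool) (m q : ℕ)
    (I : ℚ × ℚ) : (encodeFrom ctxs (win S 0 q) I (win S q m)).2 =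
      I.2 * ∏ i ∈ Finset.range m, bitWidth ctxs S (q + i) := by
  induction m generalizing q I with
  | zero => simp [encodeFrom]
  | succ m ih =>
    have e : win S 0 q ++ [S q] = win S 0 (q + 1) := by rw [win_succ, zero_add]
    rw [win_cons, encodeFrom, e, ih, snd_foldl_narrow, Finset.prod_range_succ', mul_assoc,
      mul_comm (∏ _ ∈ _, _)]
    simp [bitWidth, add_assoc, add_comm 1]

theorem length_outputBits_encodeFrom (ctxs : List Bool → List (List Bool)) (S : ℕ → Bool) (n : ℕ) :
    (outputBits (encodeFrom ctxs [] (0, 1) (initSeg S n))).length =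
      codeLength (∏ q ∈ Finset.range n, bitWidth ctxs S q) := by
  have := snd_encodeFrom_win ctxs S n 0 (0, 1)
  simp only [win_zero, zero_add, one_mul] at this
  rw [outputBits, List.length_map, List.length_range, initSeg_eq_win, this]

theorem inv_le_two_pow_codeLength {w : ℚ} : w⁻¹ ≤ 2 ^ codeLength w := by
  have h := Int.self_le_zpow_clog (b := 2) (by norm_num) w⁻¹
  refine h.trans ?_
  rw [codeLength, ← zpow_natCast]
  push_cast
  exact zpow_le_zpow_right₀ (by norm_num) (Int.self_le_toNat _)

theorem codeLength_le_of_inv_le {w : ℚ} {k : ℕ} (h : w⁻¹ ≤ 2 ^ k) : codeLength w ≤ k := by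
  rw [codeLength, Int.toNat_le]
  rcases le_or_gt w⁻¹ 0 with h0 | h0
  · rw [Int.clog_of_right_le_zero _ h0]; positivity
  · rw [← Int.le_zpow_iff_clog_le (by norm_num) h0]
    exact_mod_cast h

theorem totalFreq_pos {x c : List Bool} (h : 0 < escFreq x c) : 0 < totalFreq x c := by
  unfold totalFreq; omega

theorem freq_le_totalFreq (x c : List Bool) (b : Bool) : freq x c b ≤ totalFreq x c := by
  unfold totalFreq; cases b <;> omega

theorem width_cons (J : ℚ × ℚ) (l : List (ℚ × ℚ)) : width (J :: l) = J.2 * width l := by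
  simp [width]

theorem width_singleton (J : ℚ × ℚ) : width [J] = J.2 := by simp [width]

theorem width_encodeBit_pos {x : List Bool} {b : Bool} {cs : List (List Bool)}
    (h : ∀ c ∈ cs, 0 < escFreq x c) : 0 < width (encodeBit x b cs) := by
  induction cs with
  | nil => simp [encodeBit, width]
  | cons c cs ih =>
    have hc := h c (by simp)
    have ht : (0 : ℚ) < totalFreq x c := by exact_mod_cast totalFreq_pos hc
    rw [encodeBit]
    split_ifs with hb
    · have hb' : (0 : ℚ) < freq x c b := by exact_mod_cast hb
      rw [width_singleton, bitInterval]
      positivity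
    · have hc' : (0 : ℚ) < escFreq x c := by exact_mod_cast hc
      have := ih fun c' h' => h c' (by simp [h'])
      rw [width_cons, escInterval]
      positivity

theorem width_encodeBit_le_one (x : List Bool) (b : Bool) (cs : List (List Bool)) :
    width (encodeBit x b cs) ≤ 1 ∧ 0 ≤ width (encodeBit x b cs) := by
  induction cs with
  | nil => norm_num [encodeBit, width]
  | cons c cs ih =>
    rw [encodeBit]
    split_ifs with hb
    · rw [width_singleton, bitInterval]
      exact ⟨div_le_one_of_le₀ (by exact_mod_cast freq_le_totalFreq x c b) (by positivity),
        by positivity⟩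
    · rw [width_cons, escInterval]
      have h1 : (escFreq x c : ℚ) / totalFreq x c ≤ 1 :=
        div_le_one_of_le₀ (by norm_cast; unfold totalFreq; omega) (by positivity)
      exact ⟨mul_le_one₀ h1 ih.2 ih.1, mul_nonneg (by positivity) ih.2⟩

/-! ### Lists of suffixes -/

theorem pairwise_tails (x : List Bool) : x.tails.Pairwise fun a b => b.length < a.length := by
  induction x with
  | nil => simp
  | cons a x ih =>
    rw [List.tails_cons, List.pairwise_cons]
    refine ⟨fun y hy => ?_, ih⟩
    have := ((List.mem_tails _ _).1 hy).length_le
    simp; omega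

/-- Lengths strictly decrease along the list, so the contexts from d on form a tail with head d;
`encodeBit` can then be unfolded at d. -/
theorem filter_length_le_of_mem {R : List (List Bool)}
    (hR : R.Pairwise fun a b => b.length < a.length) {d : List Bool} (hd : d ∈ R) :
    (R.filter fun c => decide (c.length ≤ d.length)) =
      d :: R.filter fun c => decide (c.length < d.length) := by
  obtain ⟨l₁, l₂, rfl⟩ := List.append_of_mem hd
  rw [List.pairwise_append, List.pairwise_cons] at hR
  obtain ⟨-, ⟨h2, -⟩, h1⟩ := hR
  have e1 : ∀ c ∈ l₁, d.length < c.length := fun c hc => h1 c hc d (by simp)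
  have f1 : (l₁.filter fun c => decide (c.length ≤ d.length)) = [] := by
    simpa using e1
  have f2 : (l₁.filter fun c => decide (c.length < d.length)) = [] := by
    simpa using fun c hc => (e1 c hc).le
  have f3 : (l₂.filter fun c => decide (c.length ≤ d.length)) = l₂ := by
    simpa using fun c hc => (h2 c hc).le
  have f4 : (l₂.filter fun c => decide (c.length < d.length)) = l₂ := by
    simpa using h2
  simp [f1, f2, f3, f4]

/-! ### Counts of windows of the sequence -/

/-- The number of positions less than `m` at which `w` occurs in the sequence. -/
noncomputable def cnt (w : List Bool) (m : ℕ) : ℕ :=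
  ((Finset.range m).filter fun p => win seqS p w.length = w).card

theorem cnt_mono (w : List Bool) : Monotone (cnt w) := fun _ _ h =>
  Finset.card_le_card (Finset.filter_subset_filter _ (by simpa using h))

theorem cnt_le (w : List Bool) (m : ℕ) : cnt w m ≤ m :=
  (Finset.card_filter_le _ _).trans (by simp)

theorem cnt_add (w : List Bool) (m d : ℕ) :
    cnt w (m + d) = cnt w m +
      ((Finset.range d).filter fun r => win seqS (m + r) w.length = w).card := by
  simp only [cnt, Finset.card_filter, Finset.sum_range_add]

theorem cnt_le_cnt_sub_add (w : List Bool) (m d : ℕ) : cnt w m ≤ cnt w (m - d) + d := by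
  rcases le_total d m with h | h
  · obtain ⟨e, rfl⟩ := Nat.exists_eq_add_of_le' h
    rw [Nat.add_sub_cancel, cnt_add]
    have := Finset.card_filter_le (Finset.range d) fun r => win seqS (e + r) w.length = w
    simp at this
    omega
  · exact (cnt_le w m).trans (by omega)

theorem occ_win_seqS (w : List Bool) (q : ℕ) : occ w (win seqS 0 q) = cnt w (q + 1 - w.length) := by
  rw [occ_win]; simp [cnt]

theorem freq_win_seqS (c : List Bool) (b : Bool) (q : ℕ) :
    freq (win seqS 0 q) c b = cnt (c ++ [b]) (q - c.length) := by
  rw [freq, occ_win_seqS, List.length_append, List.length_singleton, Nat.add_sub_add_right]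

theorem cnt_zoneStart_succ {n : ℕ} {w : List Bool} (h : w.length ≤ n) :
    cnt w (zoneStart (n + 1)) = cnt w (zoneStart n) + n * 2 ^ (n - w.length) := by
  rcases Nat.eq_zero_or_pos n with rfl | hn
  · simp [zoneStart]
  · rw [zoneStart_succ, cnt_add, card_win_zone hn.ne' w h]

/-- A string longer than n occurs at most as often as its prefix of length n; truncated subtraction
makes the power 1. -/
theorem cnt_zoneStart_succ_le (n : ℕ) (w : List Bool) :
    cnt w (zoneStart (n + 1)) ≤ cnt w (zoneStart n) + n * 2 ^ (n - w.length) := by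
  rcases le_total w.length n with h | h
  · exact (cnt_zoneStart_succ h).le
  · rcases Nat.eq_zero_or_pos n with rfl | hn
    · simp [zoneStart]
    · have e : (w.take n).length = n := by simp [h]
      have h2 := card_win_zone hn.ne' (w.take n) e.le
      rw [zoneStart_succ, cnt_add, Nat.sub_eq_zero_of_le h, Nat.add_le_add_iff_left]
      rw [e, Nat.sub_self] at h2
      rw [← h2]
      refine Finset.card_le_card fun r hr => ?_
      rw [Finset.mem_filter] at hr ⊢
      exact ⟨hr.1, by rw [← take_win h, hr.2]⟩

theorem zoneStart_add_two_pow (m : ℕ) : zoneStart (m + 2) = m * 2 ^ (m + 2) + 2 := by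
  induction m with
  | zero => simp [zoneStart, Finset.sum_range_succ]
  | succ m ih => rw [zoneStart_succ, ih]; ring

theorem le_zoneStart_succ (m : ℕ) : m ≤ zoneStart (m + 1) := by
  rw [zoneStart_succ]
  have : m * 1 ≤ m * 2 ^ m := Nat.mul_le_mul_left _ Nat.one_le_two_pow
  omega

theorem exists_zone (q : ℕ) : ∃ m, zoneStart m ≤ q ∧ q < zoneStart (m + 1) := by
  have hex : ∃ m, q < zoneStart m := ⟨q + 1 + 1, by have := le_zoneStart_succ (q + 1); omega⟩
  classical
  have h1 := Nat.find_spec hex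
  have h0 : Nat.find hex ≠ 0 := by
    intro h
    rw [h] at h1
    simp [zoneStart] at h1
  obtain ⟨m, hm⟩ := Nat.exists_eq_succ_of_ne_zero h0
  refine ⟨m, ?_, by rw [hm] at h1; exact h1⟩
  have := Nat.find_min hex (m := m) (by omega)
  omega

/-- Zones of order at least `w.length` contribute their exact share; the error terms bound the
earlier zones trivially. -/
theorem cnt_zoneStart_bounds (w : List Bool) {m : ℕ} (h : w.length ≤ m) :
    zoneStart m ≤ 2 ^ w.length * cnt w (zoneStart m) + zoneStart w.length ∧
      2 ^ w.length * cnt w (zoneStart m) ≤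
        zoneStart m + 2 ^ w.length * zoneStart w.length := by
  induction m, h using Nat.le_induction with
  | base =>
    have := Nat.mul_le_mul_left (2 ^ w.length) (cnt_le w (zoneStart w.length))
    omega
  | succ m h ih =>
    rw [cnt_zoneStart_succ h, zoneStart_succ, Nat.mul_add]
    have : 2 ^ w.length * (m * 2 ^ (m - w.length)) = m * 2 ^ m := by
      rw [mul_left_comm, ← pow_add, Nat.add_sub_cancel' h]
    omega

/-- After long prefixes, a context has been followed almost equally often by both bits. -/
theorem exists_freq_balanced (k : ℕ) : ∃ q₀, k ≤ q₀ ∧ ∀ q ≥ q₀, ∀ c : List Bool, c.length = k →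
    (∀ b, 0 < freq (win seqS 0 q) c b) ∧
    ∀ b b', 3 * freq (win seqS 0 q) c b ≤ 7 * freq (win seqS 0 q) c b' := by
  -- E absorbs the small zones and the k + 1 positions lost at the end.
  set E := 2 ^ (k + 1) * (zoneStart (k + 1) + (k + 1)) with hE
  have hEk : k + 1 ≤ E := by
    have : 1 * (zoneStart (k + 1) + (k + 1)) ≤ E := Nat.mul_le_mul_right _ Nat.one_le_two_pow
    omega
  have hEZ : zoneStart (k + 1) + (k + 1) * 2 ^ (k + 1) ≤ E := by
    have : 1 * zoneStart (k + 1) ≤ 2 ^ (k + 1) * zoneStart (k + 1) :=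
      Nat.mul_le_mul_right _ Nat.one_le_two_pow
    rw [hE, Nat.mul_add]
    linarith
  refine ⟨zoneStart (10 * E + 10), ?_, ?_⟩
  · exact le_trans (by omega) (le_zoneStart_succ (10 * E + 9))
  intro q hq c hc
  obtain ⟨m, hm1, hm2⟩ := exists_zone q
  have hmE : 10 * E + 10 ≤ m := by
    by_contra hlt
    have := zoneStart_mono (show m + 1 ≤ 10 * E + 10 by omega)
    omega
  obtain ⟨a, rfl⟩ : ∃ a, m = a + 2 := ⟨m - 2, by omega⟩
  have z1 := zoneStart_add_two_pow a
  have z2 : zoneStart (a + 2 + 1) = (a + 1) * 2 ^ (a + 3) + 2 := zoneStart_add_two_pow (a + 1)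
  have lower : ∀ b, zoneStart (a + 2) ≤ 2 ^ (k + 1) * freq (win seqS 0 q) c b + E := by
    intro b
    have hl : (c ++ [b]).length = k + 1 := by simp [hc]
    have h1 := (cnt_zoneStart_bounds (c ++ [b]) (m := a + 2) (by omega)).1
    have h2 := cnt_le_cnt_sub_add (c ++ [b]) (zoneStart (a + 2)) (k + 1)
    have h3 := cnt_mono (c ++ [b]) (show zoneStart (a + 2) - (k + 1) ≤ q - k by omega)
    rw [freq_win_seqS, hc]
    rw [hl] at h1
    have h4 := Nat.mul_le_mul_left (2 ^ (k + 1)) (h2.trans (Nat.add_le_add_right h3 _))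
    rw [Nat.mul_add] at h4
    linarith
  have upper : ∀ b, 2 ^ (k + 1) * freq (win seqS 0 q) c b ≤ zoneStart (a + 3) + E := by
    intro b
    have hl : (c ++ [b]).length = k + 1 := by simp [hc]
    have h1 := (cnt_zoneStart_bounds (c ++ [b]) (m := a + 3) (by omega)).2
    have h3 := cnt_mono (c ++ [b]) ((Nat.sub_le q k).trans hm2.le : q - k ≤ zoneStart (a + 3))
    rw [freq_win_seqS, hc]
    rw [hl] at h1
    have h4 := Nat.mul_le_mul_left (2 ^ (k + 1)) h3
    have h5 : 2 ^ (k + 1) * zoneStart (k + 1) ≤ E := Nat.mul_le_mul_left _ (by omega)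
    omega
  -- With P = 2^(a+2), three times the upper bound is at most seven times the lower one if and only
  -- if aP ≥ 6P + 10E - 8.
  have hbig : (10 * E + 8) * 2 ^ (a + 2) ≤ a * 2 ^ (a + 2) := Nat.mul_le_mul_right _ (by omega)
  have h1p : 1 ≤ 2 ^ (a + 2) := Nat.one_le_two_pow
  have hbig2 : E * 1 ≤ E * 2 ^ (a + 2) := Nat.mul_le_mul_left _ h1p
  have hz2 : zoneStart (a + 3) = 2 * (a * 2 ^ (a + 2)) + 2 * 2 ^ (a + 2) + 2 := by
    rw [show a + 3 = a + 2 + 1 from rfl, z2]; ring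
  have hb' : (10 * E + 8) * 2 ^ (a + 2) = 10 * (E * 2 ^ (a + 2)) + 8 * 2 ^ (a + 2) := by ring
  constructor
  · intro b
    have := lower b
    by_contra h0
    rw [Nat.eq_zero_of_not_pos h0] at this
    omega
  · intro b b'
    have hu := upper b
    have hlo := lower b'
    have hpos : 0 < 2 ^ (k + 1) := by positivity
    refine Nat.le_of_mul_le_mul_left ?_ hpos
    have e1 : 2 ^ (k + 1) * (3 * freq (win seqS 0 q) c b) =
      3 * (2 ^ (k + 1) * freq (win seqS 0 q) c b) := by ring
    have e2 : 2 ^ (k + 1) * (7 * freq (win seqS 0 q) c b') =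
      7 * (2 ^ (k + 1) * freq (win seqS 0 q) c b') := by ring
    rw [e1, e2]
    omega

/-! ### Bounded PPM -/

theorem mem_boundedContexts {x c : List Bool} {k : ℕ} :
    c ∈ boundedContexts k x ↔ c <:+ x ∧ c.length ≤ k ∧ 0 < escFreq x c := by
  simp only [boundedContexts, List.mem_filter, List.mem_tails, decide_eq_true_eq]
  rfl

theorem boundedContexts_eq_cons {x c : List Bool} {k : ℕ} (hc : c <:+ x) (hk : c.length = k)
    (he : 0 < escFreq x c) : ∃ cs, boundedContexts k x = c :: cs := by
  have hmem : c ∈ boundedContexts k x := by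
    simp [mem_boundedContexts, hc, hk, he]
  have hp : (boundedContexts k x).Pairwise fun a b => b.length < a.length :=
    (pairwise_tails x).filter _
  refine ⟨_, Eq.trans ?_ (filter_length_le_of_mem hp hmem)⟩
  symm
  rw [List.filter_eq_self]
  intro d hd
  have := (mem_boundedContexts.1 hd).2.1
  simp only [decide_eq_true_eq]
  omega

theorem bitWidth_bounded_pos (k : ℕ) (S : ℕ → Bool) (q : ℕ) :
    0 < bitWidth (boundedContexts k) S q := by
  refine width_encodeBit_pos fun c hc => ?_
  exact (mem_boundedContexts.1 hc).2.2

theorem exists_bitWidth_bounded_le (k : ℕ) :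
    ∃ q₀, ∀ q ≥ q₀, bitWidth (boundedContexts k) seqS q ≤ 7 / 10 := by
  obtain ⟨q₀, hk, h⟩ := exists_freq_balanced k
  refine ⟨q₀, fun q hq => ?_⟩
  obtain ⟨hpos, hbal⟩ := h q hq (win seqS (q - k) k) (by simp)
  set c := win seqS (q - k) k
  have hc : c <:+ win seqS 0 q := by
    have := win_suffix (S := seqS) (p := 0) (show k ≤ q by omega)
    simpa using this
  have he : 0 < escFreq (win seqS 0 q) c := by
    simp [escFreq, hpos]
  obtain ⟨cs, hcs⟩ := boundedContexts_eq_cons (k := k) hc (by simp [c]) he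
  rw [bitWidth, hcs, encodeBit, if_pos (hpos _), width_singleton, bitInterval]
  have h1 := hbal (seqS q) (!(seqS q))
  have h2 : freq (win seqS 0 q) c (seqS q) + freq (win seqS 0 q) c (!(seqS q)) ≤
      totalFreq (win seqS 0 q) c := by
    unfold totalFreq
    cases seqS q <;> simp only [Bool.not_true, Bool.not_false] <;> omega
  rw [div_le_div_iff₀ (by exact_mod_cast totalFreq_pos he) (by norm_num)]
  norm_cast
  omega

theorem eventually_le_two_mul_length_bounded (k : ℕ) :
    ∀ᶠ N in atTop, N ≤ 2 * (bounded k (initSeg seqS N)).length := by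
  obtain ⟨q₀, hq⟩ := exists_bitWidth_bounded_le k
  -- 50/49 = (10/7)^2 / 2 is the surplus per bit over rate 1/2; it pays for the first `q₀` bits.
  have ht : Tendsto (fun d : ℕ => (50 / 49 : ℚ) ^ d) atTop atTop :=
    tendsto_pow_atTop_atTop_of_one_lt (by norm_num)
  obtain ⟨d₀, hd₀⟩ := eventually_atTop.1 (ht.eventually_ge_atTop (2 ^ q₀))
  filter_upwards [eventually_ge_atTop (q₀ + d₀)] with N hN
  obtain ⟨d, rfl⟩ := Nat.exists_eq_add_of_le (show q₀ ≤ N by omega)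
  rw [bounded, length_outputBits_encodeFrom]
  set w := ∏ q ∈ Finset.range (q₀ + d), bitWidth (boundedContexts k) seqS q with hw
  have hw0 : 0 < w := Finset.prod_pos fun q _ => bitWidth_bounded_pos k seqS q
  have hw1 : w ≤ (7 / 10) ^ d := by
    rw [hw, Finset.prod_range_add]
    have h1 : ∏ q ∈ Finset.range q₀, bitWidth (boundedContexts k) seqS q ≤ 1 :=
      Finset.prod_le_one (fun q _ => (bitWidth_bounded_pos k seqS q).le)
        fun q _ => (width_encodeBit_le_one _ _ _).1
    have h2 : ∏ i ∈ Finset.range d, bitWidth (boundedContexts k) seqS (q₀ + i) ≤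
        ∏ _i ∈ Finset.range d, (7 / 10 : ℚ) :=
      Finset.prod_le_prod (fun i _ => (bitWidth_bounded_pos k seqS _).le)
        fun i _ => hq _ (by omega)
    rw [Finset.prod_const, Finset.card_range] at h2
    calc _ ≤ 1 * ∏ i ∈ Finset.range d, bitWidth (boundedContexts k) seqS (q₀ + i) :=
          mul_le_mul_of_nonneg_right h1
            (Finset.prod_nonneg fun i _ => (bitWidth_bounded_pos k seqS _).le)
      _ ≤ _ := by rw [one_mul]; exact h2
  have h3 : ((10 / 7 : ℚ)) ^ d ≤ 2 ^ codeLength w := by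
    refine le_trans ?_ inv_le_two_pow_codeLength
    rw [le_inv_comm₀ (by positivity) hw0, ← inv_pow]
    norm_num at hw1 ⊢
    exact hw1
  have h4 : (2 : ℚ) ^ (q₀ + d) ≤ 2 ^ (2 * codeLength w) := by
    calc (2 : ℚ) ^ (q₀ + d) = 2 ^ q₀ * 2 ^ d := pow_add _ _ _
      _ ≤ (50 / 49) ^ d * 2 ^ d := by
        gcongr
        exact hd₀ d (by omega)
      _ = ((10 / 7) ^ d) ^ 2 := by rw [← mul_pow, ← pow_mul, mul_comm d 2, pow_mul]; norm_num
      _ ≤ (2 ^ codeLength w) ^ 2 := by gcongr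
      _ = _ := by rw [← pow_mul, mul_comm]
  exact (pow_le_pow_iff_right₀ (by norm_num)).1 h4

theorem half_le_bestRatio_bounded (k : ℕ) : (1 / 2 : ℝ≥0∞) ≤ bestRatio (bounded k) seqS := by
  refine le_liminf_of_le (by isBoundedDefault) ?_
  filter_upwards [eventually_le_two_mul_length_bounded k, eventually_gt_atTop 0] with N hN h0
  rw [ENNReal.le_div_iff_mul_le (by simp [h0.ne']) (by simp), one_div]
  have : (N : ℝ≥0∞) ≤ 2 * ((bounded k (initSeg seqS N)).length : ℝ≥0∞) := by exact_mod_cast hN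
  calc (2 : ℝ≥0∞)⁻¹ * N ≤ 2⁻¹ * (2 * ((bounded k (initSeg seqS N)).length : ℝ≥0∞)) := by gcongr
    _ = _ := by rw [← mul_assoc, ENNReal.inv_mul_cancel (by norm_num) (by norm_num), one_mul]

/-! ### The contexts of PPM* -/

theorem freq_win (S : ℕ → Bool) (c : List Bool) (b : Bool) (q : ℕ) :
    freq (win S 0 q) c b = ((Finset.range (q - c.length)).filter fun i =>
      win S i (c.length + 1) = c ++ [b]).card := by
  rw [freq, occ_win, List.length_append, List.length_singleton, Nat.add_sub_add_right]
  simp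

theorem escFreq_pos_iff {x c : List Bool} : 0 < escFreq x c ↔ ∃ b, 0 < freq x c b := by
  unfold escFreq
  constructor
  · intro h
    by_cases hf : 0 < freq x c false
    · exact ⟨false, hf⟩
    · by_cases ht : 0 < freq x c true
      · exact ⟨true, ht⟩
      · simp [hf, ht] at h
  · rintro ⟨b, hb⟩
    cases b <;> simp [hb]

theorem eq_win_of_suffix {S : ℕ → Bool} {q : ℕ} {c : List Bool} (h : c <:+ win S 0 q) :
    c = win S (q - c.length) c.length ∧ c.length ≤ q := by
  have hl : c.length ≤ q := by simpa using h.length_le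
  have h2 := win_suffix (S := S) (p := 0) hl
  rw [zero_add] at h2
  exact ⟨(List.suffix_of_suffix_length_le h h2 (by simp)).eq_of_length (by simp), hl⟩

/-- A suffix of the input that has been followed by a bit is in the model of PPM*. -/
theorem inStarModel_of_suffix {S : ℕ → Bool} {q : ℕ} {c : List Bool} (h : c <:+ win S 0 q)
    (he : 0 < escFreq (win S 0 q) c) : InStarModel (win S 0 q) c := by
  refine ⟨?_, he⟩
  by_cases hc : c = []
  · exact Or.inl hc
  right
  obtain ⟨b, hb⟩ := escFreq_pos_iff.1 he
  rw [freq_win, Finset.card_pos] at hb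
  obtain ⟨i, hi⟩ := hb
  rw [Finset.mem_filter, Finset.mem_range] at hi
  obtain ⟨hcw, hl⟩ := eq_win_of_suffix h
  have hl0 : 0 < c.length := List.length_pos_iff.2 hc
  have hd : ∀ p, win S p c.length = c → win S p (c.length - 1) = c.dropLast := by
    intro p hp
    rw [List.dropLast_eq_take]
    conv_rhs => rw [← hp]
    rw [length_win, take_win (by omega)]
  have hic : win S i c.length = c := by
    rw [win_succ] at hi
    exact (List.append_inj hi.2 (by simp)).1
  rw [occ_win, List.length_dropLast]
  -- One occurrence was followed by a bit, the other ends the input; hence they differ.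
  have hsub : ({i, q - c.length} : Finset ℕ) ⊆ (Finset.range (q + 1 - (c.length - 1))).filter
      fun p => win S (0 + p) (c.length - 1) = c.dropLast := by
    intro p hp
    rw [Finset.mem_insert, Finset.mem_singleton] at hp
    rw [Finset.mem_filter, Finset.mem_range, zero_add]
    rcases hp with rfl | rfl
    · exact ⟨by omega, hd _ hic⟩
    · exact ⟨by omega, hd _ hcw.symm⟩
  refine le_trans ?_ (Finset.card_le_card hsub)
  rw [Finset.card_pair (by omega)]

theorem mem_starRelevant {S : ℕ → Bool} {q : ℕ} {c : List Bool} :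
    c ∈ starRelevant (win S 0 q) ↔ c <:+ win S 0 q ∧ 0 < escFreq (win S 0 q) c := by
  simp only [starRelevant, List.mem_filter, List.mem_tails, decide_eq_true_eq]
  exact ⟨fun h => ⟨h.1, h.2.2⟩, fun h => ⟨h.1, inStarModel_of_suffix h.1 h.2⟩⟩

theorem pairwise_starRelevant (x : List Bool) :
    (starRelevant x).Pairwise fun a b => b.length < a.length := (pairwise_tails x).filter _

/-- PPM* starts at the shortest deterministic relevant context, if there is one. -/
theorem starContexts_cases (x : List Bool) :
    (starContexts x = starRelevant x ∧ ∀ c ∈ starRelevant x, ¬ IsDet x c) ∨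
    ∃ d ∈ starRelevant x, IsDet x d ∧ (∀ c ∈ starRelevant x, IsDet x c → d.length ≤ c.length) ∧
      starContexts x = d :: (starRelevant x).filter fun c => decide (c.length < d.length) := by
  have hR := pairwise_starRelevant x
  unfold starContexts
  cases h : ((starRelevant x).filter fun c => decide (IsDet x c)).getLast? with
  | none =>
    left
    refine ⟨rfl, ?_⟩
    rw [List.getLast?_eq_none_iff, List.filter_eq_nil_iff] at h
    simpa using h
  | some d =>
    right
    obtain ⟨l, hl⟩ := List.getLast?_eq_some_iff.1 h
    have hmem : ∀ c, c ∈ starRelevant x ∧ IsDet x c ↔ c ∈ l ++ [d] := by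
      intro c
      rw [← hl]
      simp
    have hd := (hmem d).2 (by simp)
    refine ⟨d, hd.1, hd.2, fun c hc hdet => ?_, filter_length_le_of_mem hR hd.1⟩
    have hp : (l ++ [d]).Pairwise fun a b => b.length < a.length := by
      rw [← hl]; exact hR.filter _
    rw [List.pairwise_append] at hp
    rcases List.mem_append.1 ((hmem c).1 ⟨hc, hdet⟩) with hcl | hcd
    · exact (hp.2.2 c hcl d (by simp)).le
    · rw [List.mem_singleton.1 hcd]

theorem freq_pos_of_not_isDet {x c : List Bool} (h : 0 < escFreq x c) (hd : ¬ IsDet x c)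
    (b : Bool) : 0 < freq x c b := by
  by_contra hb
  unfold IsDet escFreq at hd
  unfold escFreq at h
  cases b <;> rw [if_neg hb] at h hd <;> split_ifs at h hd <;> omega

/-- The first context already knows the bit, so nothing is escaped; `2 ≤ T` covers the empty list.
-/
theorem le_width_encodeBit_of_freq_pos {x : List Bool} {b : Bool} {cs : List (List Bool)} {T : ℕ}
    (hT : 2 ≤ T) (h : ∀ c ∈ cs, 0 < freq x c b) (hh : ∀ c, cs.head? = some c → totalFreq x c ≤ T) :
    (1 : ℚ) / T ≤ width (encodeBit x b cs) := by
  have hT' : (2 : ℚ) ≤ T := by exact_mod_cast hT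
  cases cs with
  | nil =>
    rw [encodeBit, width_singleton]
    exact one_div_le_one_div_of_le (by norm_num) hT'
  | cons c cs =>
    have hc := h c (by simp)
    have ht := freq_le_totalFreq x c b
    have hle : (totalFreq x c : ℚ) ≤ T := by exact_mod_cast hh c rfl
    have hc' : (1 : ℚ) ≤ freq x c b := by exact_mod_cast hc
    have ht' : (0 : ℚ) < totalFreq x c := by exact_mod_cast lt_of_lt_of_le hc ht
    rw [encodeBit, if_pos hc, width_singleton, bitInterval]
    exact div_le_div₀ (by positivity) hc' ht' hle

/-- A lower bound for the probability that PPM* assigns to a bit. -/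
theorem le_bitWidth_star {S : ℕ → Bool} {q m T : ℕ} (hT : 2 ≤ T) (hq : m ≤ q + 3)
    (h1 : ∀ c : List Bool, m ≤ c.length + 3 → totalFreq (win S 0 q) c ≤ T)
    (h2 : ∀ (c : List Bool) (b : Bool), c.length + 3 ≤ m → 0 < freq (win S 0 q) c b) :
    (1 : ℚ) / T ^ 2 ≤ bitWidth starContexts S q := by
  set x := win S 0 q with hx
  have hT' : (2 : ℚ) ≤ T := by exact_mod_cast hT
  have hTT : (1 : ℚ) / T ^ 2 ≤ 1 / T :=
    one_div_le_one_div_of_le (by positivity) (by nlinarith)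
  have hlong : ∀ e : List Bool, e.length + 3 ≤ m → ¬ IsDet x e := by
    intro e he hd
    have ht := h2 e true he
    have hf := h2 e false he
    simp [IsDet, escFreq, ht, hf] at hd
  have hsuf : ∀ k, k + 3 ≤ m → ∃ e ∈ starRelevant x, e.length = k := by
    intro k hk
    refine ⟨win S (q - k) k, mem_starRelevant.2 ⟨?_, escFreq_pos_iff.2 ⟨true, h2 _ _ (by simpa)⟩⟩,
      by simp⟩
    have := win_suffix (S := S) (p := 0) (show k ≤ q by omega)
    simpa using this
  -- All suffixes of length at most m - 3 are relevant, so the longest context in the list is no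
  -- shorter than that and has total at most T.
  have hhead : ∀ cs : List (List Bool), (cs.Pairwise fun a b => b.length < a.length) →
      (∀ e ∈ starRelevant x, e.length + 3 ≤ m → e ∈ cs) →
      ∀ c, cs.head? = some c → totalFreq x c ≤ T := by
    intro cs hp he c hc
    apply h1
    by_contra hlt
    obtain ⟨e, heR, hel⟩ := hsuf (c.length + 1) (by omega)
    have hecs := he e heR (by omega)
    cases cs with
    | nil => simp at hc
    | cons c' cs =>
      obtain rfl : c' = c := by simpa using hc
      rw [List.mem_cons] at hecs
      rcases hecs with rfl | hecs
      · omega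
      · have := (List.pairwise_cons.1 hp).1 e hecs
        omega
  unfold bitWidth
  rw [← hx]
  rcases starContexts_cases x with ⟨e, hnd⟩ | ⟨d, hd, hdet, hmin, e⟩
  · rw [e]
    refine hTT.trans (le_width_encodeBit_of_freq_pos hT (fun c hc => ?_)
      (hhead _ (pairwise_starRelevant x) fun e he _ => he))
    exact freq_pos_of_not_isDet (mem_starRelevant.1 hc).2 (hnd c hc) _
  · rw [e]
    have hdl : m < d.length + 3 := by
      by_contra hlt
      exact hlong d (by omega) hdet
    have hdT : (totalFreq x d : ℚ) ≤ T := by exact_mod_cast h1 d hdl.le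
    have hd0 : 0 < escFreq x d := (mem_starRelevant.1 hd).2
    have ht0 : (0 : ℚ) < totalFreq x d := by exact_mod_cast totalFreq_pos hd0
    rw [encodeBit]
    split_ifs with hb
    · refine hTT.trans ?_
      rw [width_singleton, bitInterval]
      exact div_le_div₀ (by positivity) (by exact_mod_cast hb) ht0 hdT
    -- After this escape only contexts shorter than d remain. By minimality of d none is
    -- deterministic, so no second escape occurs.
    · rw [width_cons, escInterval, sq, ← one_div_mul_one_div]
      have hcs := le_width_encodeBit_of_freq_pos (b := S q) hT
        (cs := (starRelevant x).filter fun c => decide (c.length < d.length)) (fun c hc => by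
          rw [List.mem_filter, decide_eq_true_eq] at hc
          refine freq_pos_of_not_isDet (mem_starRelevant.1 hc.1).2 (fun hcd => ?_) _
          have := hmin c hc.1 hcd
          omega)
        (hhead _ ((pairwise_starRelevant x).filter _) fun e he hle => by
          rw [List.mem_filter, decide_eq_true_eq]
          exact ⟨he, by omega⟩)
      have h3 : (1 : ℚ) / T ≤ escFreq x d / totalFreq x d :=
        div_le_div₀ (by positivity) (by exact_mod_cast hd0) ht0 hdT
      exact mul_le_mul h3 hcs (by positivity) (by positivity)

theorem freq_le_freq_of_suffix {S : ℕ → Bool} {q : ℕ} {u d : List Bool} (h : d <:+ u) (b : Bool) :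
    freq (win S 0 q) u b ≤ freq (win S 0 q) d b := by
  obtain ⟨v, rfl⟩ := h
  rw [freq_win, freq_win]
  refine Finset.card_le_card_of_injOn (fun i => i + v.length) (fun i hi => ?_)
    (fun i _ j _ hij => by simpa using hij)
  simp only [Finset.coe_filter, Finset.mem_range, Set.mem_ofPred_eq, List.length_append] at hi ⊢
  refine ⟨by omega, ?_⟩
  have h2 := hi.2
  rw [add_assoc, win_add, List.append_assoc] at h2
  exact (List.append_inj h2 (by simp)).2

/-- A lower bound for the probability that PPM* assigns to a bit when the last `l` bits have
been seen `a` times before and always with the same continuation. -/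
theorem le_bitWidth_star_of_repeat {S : ℕ → Bool} {q l a : ℕ} (hl : l ≤ q) (ha : 0 < a)
    (hcount : a ≤ ((Finset.range (q - l)).filter fun p => win S p l = win S (q - l) l).card)
    (hdet : ∀ p < q - l, win S p l = win S (q - l) l → S (p + l) = S q) :
    1 - 1 / ((a : ℚ) + 1) ≤ bitWidth starContexts S q := by
  set u := win S (q - l) l with hu
  set x := win S 0 q with hx
  have hul : u.length = l := by simp [hu]
  have hux : u <:+ x := by
    have := win_suffix (S := S) (p := 0) hl
    simpa using this
  have hfreq : a ≤ freq x u (S q) := by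
    refine hcount.trans ?_
    rw [hx, freq_win, hul]
    refine Finset.card_le_card fun p hp => ?_
    rw [Finset.mem_filter, Finset.mem_range] at hp ⊢
    exact ⟨hp.1, by rw [win_succ, hp.2, hdet p hp.1 hp.2]⟩
  have hfreq0 : freq x u (!(S q)) = 0 := by
    rw [hx, freq_win, hul, Finset.card_eq_zero, Finset.filter_eq_empty_iff]
    intro p hp h
    rw [win_succ] at h
    obtain ⟨h1, h2⟩ := List.append_inj h (by simp [hul])
    have := hdet p (Finset.mem_range.1 hp) h1
    simp [this] at h2
  have hudet : IsDet x u := by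
    have h1 : 0 < freq x u (S q) := by omega
    unfold IsDet escFreq
    cases hS : S q <;> rw [hS] at h1 hfreq0 <;> simp at hfreq0 <;> simp [h1, hfreq0]
  have huR : u ∈ starRelevant x :=
    mem_starRelevant.2 ⟨hux, escFreq_pos_iff.2 ⟨S q, lt_of_lt_of_le ha hfreq⟩⟩
  rcases starContexts_cases x with ⟨-, hnd⟩ | ⟨d, hd, hdd, hmin, e⟩
  · exact absurd hudet (hnd u huR)
  -- As a suffix of u, the starting context d has seen `S q` at least as often. Being deterministic,
  -- it has seen nothing else.
  · have hdu : d <:+ u :=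
      List.suffix_of_suffix_length_le (mem_starRelevant.1 hd).1 hux (hmin u huR hudet)
    have hfd : a ≤ freq x d (S q) := hfreq.trans (freq_le_freq_of_suffix hdu _)
    have htot : totalFreq x d = freq x d (S q) + 1 := by
      have h1 : 0 < freq x d (S q) := by omega
      unfold IsDet at hdd
      unfold totalFreq
      rw [hdd]
      unfold escFreq at hdd
      cases hS : S q <;> rw [hS] at h1 <;> simp [h1] at hdd <;> omega
    unfold bitWidth
    rw [← hx, e, encodeBit, if_pos (by omega), width_singleton, bitInterval, htot]
    have hfd' : (a : ℚ) ≤ freq x d (S q) := by exact_mod_cast hfd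
    have e2 : ((freq x d (S q) : ℕ) : ℚ) / ((freq x d (S q) + 1 : ℕ) : ℚ) =
        1 - 1 / ((freq x d (S q) : ℚ) + 1) := by
      push_cast
      field_simp
      ring
    simp only [e2]
    gcongr

/-! ### The windows of an initial part of the sequence -/

/-- Each of the zones up to n contributes at most n 2^d occurrences. -/
theorem cnt_zoneStart_succ_le_of_length (n d : ℕ) (w : List Bool) (hw : n ≤ w.length + d) :
    cnt w (zoneStart (n + 1)) ≤ 2 ^ d * (n * (n + 1)) := by
  have key : ∀ m ≤ n + 1, cnt w (zoneStart m) ≤ m * (2 ^ d * n) := by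
    intro m
    induction m with
    | zero => simp [zoneStart, cnt]
    | succ m ih =>
      intro hm
      have h1 := cnt_zoneStart_succ_le m w
      have h2 := ih (by omega)
      have h3 : m * 2 ^ (m - w.length) ≤ n * 2 ^ d :=
        Nat.mul_le_mul (by omega) (Nat.pow_le_pow_right (by omega) (by omega))
      rw [Nat.succ_mul, mul_comm (2 ^ d) n] at *
      omega
  exact (key (n + 1) le_rfl).trans (by ring_nf; rfl)

theorem totalFreq_zone_le {q m n : ℕ} (hm : q < zoneStart (m + 1)) (hmn : m ≤ n) (c : List Bool)
    (hc : m ≤ c.length + 3) : totalFreq (win seqS 0 q) c ≤ 8 * (n + 1) ^ 2 := by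
  have hf : ∀ b, freq (win seqS 0 q) c b ≤ 4 * (n * (n + 1)) := by
    intro b
    rw [freq_win_seqS]
    refine (cnt_mono _ ((Nat.sub_le q _).trans hm.le)).trans
      ((cnt_zoneStart_succ_le_of_length m 2 (c ++ [b]) (by simp; omega)).trans ?_)
    have : m * (m + 1) ≤ n * (n + 1) := Nat.mul_le_mul hmn (by omega)
    omega
  have he : escFreq (win seqS 0 q) c ≤ 2 := by
    unfold escFreq; split_ifs <;> omega
  have h1 := hf false
  have h2 := hf true
  unfold totalFreq
  nlinarith

/-- `c ++ [b]` has length at most m - 2, so it begins somewhere in zone m - 2; zone m - 1 is long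
enough for that occurrence to be complete. -/
theorem freq_pos_of_zone {q m : ℕ} (hq : zoneStart m ≤ q) (c : List Bool) (b : Bool)
    (hc : c.length + 3 ≤ m) : 0 < freq (win seqS 0 q) c b := by
  obtain ⟨a, rfl⟩ : ∃ a, m = a + 2 := ⟨m - 2, by omega⟩
  have h1 := cnt_zoneStart_succ (n := a) (w := c ++ [b]) (by simp; omega)
  have h2 : 0 < a * 2 ^ (a - (c ++ [b]).length) := Nat.mul_pos (by omega) (by positivity)
  have h3 : zoneStart (a + 1 + 1) = zoneStart (a + 1) + (a + 1) * 2 ^ (a + 1) := zoneStart_succ _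
  have h4 : (a + 1) * 1 ≤ (a + 1) * 2 ^ (a + 1) := Nat.mul_le_mul_left _ Nat.one_le_two_pow
  rw [show a + 1 + 1 = a + 2 from rfl] at h3
  have h5 := cnt_mono (c ++ [b]) (show zoneStart (a + 1) ≤ q - c.length by omega)
  rw [freq_win_seqS]
  omega

theorem le_bitWidth_star_seqS {q n : ℕ} (hq : q < zoneStart (n + 1)) :
    (1 : ℚ) / ((8 * (n + 1) ^ 2 : ℕ) : ℚ) ^ 2 ≤ bitWidth starContexts seqS q := by
  obtain ⟨m, hm1, hm2⟩ := exists_zone q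
  have hmn : m ≤ n := by
    by_contra h
    have := zoneStart_mono (show n + 1 ≤ m by omega)
    omega
  have hqm : m ≤ q + 3 := by
    rcases Nat.eq_zero_or_pos m with rfl | h
    · omega
    · obtain ⟨a, rfl⟩ : ∃ a, m = a + 1 := ⟨m - 1, by omega⟩
      have := le_zoneStart_succ a
      omega
  have hT : 2 ≤ 8 * (n + 1) ^ 2 := by nlinarith
  exact le_bitWidth_star hT hqm (totalFreq_zone_le hm2 hmn) (freq_pos_of_zone hm1)

/-- The windows of length `l` that begin at the first `M` positions. -/
noncomputable def windows (M l : ℕ) : Finset (List Bool) :=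
  (Finset.range M).image fun p => win seqS p l

/-- The windows of length `l` that begin at the first `M` positions, and have both continuations
there. -/
noncomputable def specialWindows (M l : ℕ) : Finset (List Bool) :=
  (windows M l).filter fun u => ∀ b, u ++ [b] ∈ windows M (l + 1)

/-- Every window has a continuation, and the special ones have two. -/
theorem card_windows_add_card_special_le (M l : ℕ) :
    (windows M l).card + (specialWindows M l).card ≤ (windows M (l + 1)).card := by
  classical
  let F : Bool → Finset (List Bool) := fun b =>
    (windows M l).filter fun u => u ++ [b] ∈ windows M (l + 1)
  have hun : F false ∪ F true = windows M l := by
    rw [← Finset.filter_or, Finset.filter_eq_self]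
    intro u hu
    obtain ⟨p, hp, rfl⟩ := Finset.mem_image.1 hu
    have : win seqS p l ++ [seqS (p + l)] ∈ windows M (l + 1) := by
      rw [← win_succ]; exact Finset.mem_image_of_mem (fun p => win seqS p (l + 1)) hp
    cases h : seqS (p + l) <;> rw [h] at this
    · exact Or.inl this
    · exact Or.inr this
  have hin : F false ∩ F true = specialWindows M l := by
    rw [← Finset.filter_and]
    exact Finset.filter_congr fun u _ => by simp
  have hinj : ∀ b : Bool, Function.Injective fun u : List Bool => u ++ [b] :=
    fun b u v h => by simpa using h
  rw [← hun, ← hin, Finset.card_union_add_card_inter,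
    ← Finset.card_image_of_injective (F false) (hinj false),
    ← Finset.card_image_of_injective (F true) (hinj true), ← Finset.card_union_of_disjoint]
  · refine Finset.card_le_card fun v hv => ?_
    rw [Finset.mem_union, Finset.mem_image, Finset.mem_image] at hv
    rcases hv with ⟨u, hu, rfl⟩ | ⟨u, hu, rfl⟩ <;> exact (Finset.mem_filter.1 hu).2
  · rw [Finset.disjoint_left]
    intro v h1 h2
    obtain ⟨u, -, rfl⟩ := Finset.mem_image.1 h1
    obtain ⟨u', -, h⟩ := Finset.mem_image.1 h2
    have := (List.append_inj' h rfl).2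
    simp at this

/-- Otherwise the number of windows would grow by more than M/K at each of K lengths and exceed the
number M of positions. -/
theorem exists_few_special (M n : ℕ) {K : ℕ} (hK : 0 < K) :
    ∃ l, n ≤ l ∧ l < n + K ∧ K * (specialWindows M l).card ≤ M := by
  by_contra hcon
  push Not at hcon
  have hsum : ∀ k, (windows M n).card + ∑ i ∈ Finset.range k, (specialWindows M (n + i)).card ≤
      (windows M (n + k)).card := by
    intro k
    induction k with
    | zero => simp
    | succ k ih =>
      rw [Finset.sum_range_succ]
      have := card_windows_add_card_special_le M (n + k)
      rw [← add_assoc n k 1]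
      omega
  have hM : (windows M (n + K)).card ≤ M := Finset.card_image_le.trans (by simp)
  have h1 : ∑ i ∈ Finset.range K, M < ∑ i ∈ Finset.range K, K * (specialWindows M (n + i)).card :=
    Finset.sum_lt_sum_of_nonempty (by simpa using hK.ne') fun i hi => by
      rw [Finset.mem_range] at hi
      exact hcon (n + i) (by omega) (by omega)
  rw [← Finset.mul_sum, Finset.sum_const, Finset.card_range, smul_eq_mul] at h1
  have h2 := Nat.lt_of_mul_lt_mul_left h1
  have h3 := hsum K
  omega

/-- The number of earlier positions with the same window of length `l`. -/
noncomputable def rank (l p : ℕ) : ℕ :=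
  ((Finset.range p).filter fun p' => win seqS p' l = win seqS p l).card

/-- The rank increases strictly along the occurrences of a window, so each window accounts for at
most A positions. -/
theorem card_rank_lt_le (M l A : ℕ) :
    ((Finset.range M).filter fun p => rank l p < A).card ≤ A * (windows M l).card := by
  refine Finset.card_le_mul_card_image_of_maps_to (f := fun p => win seqS p l) (fun p hp => ?_) A
    fun u _ => ?_
  · exact Finset.mem_image_of_mem (fun p => win seqS p l) (Finset.mem_filter.1 hp).1
  · have hlt : ∀ p p', p < p' → win seqS p l = win seqS p' l → rank l p < rank l p' := by
      intro p p' hpp h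
      refine Finset.card_lt_card ⟨fun r hr => ?_, fun hsub => ?_⟩
      · rw [Finset.mem_filter, Finset.mem_range] at hr ⊢
        exact ⟨by omega, hr.2.trans h⟩
      · have := hsub (Finset.mem_filter.2 ⟨Finset.mem_range.2 hpp, h⟩)
        simp at this
    rw [← Finset.card_range A]
    refine Finset.card_le_card_of_injOn (rank l) (fun p hp => ?_) fun p hp p' hp' h => ?_
    · simp only [Finset.coe_filter, Finset.mem_filter, Finset.mem_range,
        Set.mem_ofPred_eq] at hp
      simpa using hp.1.2
    · simp only [Finset.coe_filter, Finset.mem_filter, Finset.mem_range,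
        Set.mem_ofPred_eq] at hp hp'
      rcases lt_trichotomy p p' with hlt' | heq | hgt
      · have := hlt p p' hlt' (hp.2.trans hp'.2.symm); omega
      · exact heq
      · have := hlt p' p hgt (hp'.2.trans hp.2.symm); omega

theorem card_special_positions_le (n l : ℕ) (hl : n ≤ l) (M : ℕ) (hM : M = zoneStart (n + 1)) :
    ((Finset.range M).filter fun p => win seqS p l ∈ specialWindows M l).card ≤
      n * (n + 1) * (specialWindows M l).card := by
  refine Finset.card_le_mul_card_image_of_maps_to (f := fun p => win seqS p l) (fun p hp => ?_) _
    fun u hu => ?_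
  · exact (Finset.mem_filter.1 hp).2
  · obtain ⟨p, -, hp⟩ := Finset.mem_image.1 (Finset.mem_filter.1 hu).1
    have hul : u.length = l := by rw [← hp]; simp
    have h := cnt_zoneStart_succ_le_of_length n 0 u (by omega)
    rw [pow_zero, one_mul, ← hM] at h
    refine le_trans (Finset.card_le_card fun r hr => ?_) h
    rw [Finset.mem_filter, Finset.mem_filter] at hr
    rw [Finset.mem_filter, hul]
    exact ⟨hr.1.1, hr.2⟩

/-- A window inside one block is one of 2^n windows of the periodic de Bruijn sequence. Windows
crossing a block's end begin at fewer than l places in each of at most n blocks. -/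
theorem card_windows_zone_le (n l : ℕ) :
    ((Finset.range (n * 2 ^ n)).image fun r => win seqS (zoneStart n + r) l).card ≤
      2 ^ n + n * l := by
  classical
  rcases Nat.eq_zero_or_pos n with rfl | hn
  · simp
  have hB : 0 < blockLen n := lt_of_lt_of_le (by positivity) (two_pow_le_blockLen hn.ne')
  set X := (Finset.range (n * 2 ^ n)).filter fun r => blockLen n < r % blockLen n + l with hX
  have hXcard : X.card ≤ n * l := by
    rw [hX, Finset.card_filter, ← numBlocks_mul_blockLen,
      sum_range_mul_mod (fun o => if blockLen n < o + l then 1 else 0)]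
    refine Nat.mul_le_mul (numBlocks_le hn.ne') ?_
    rw [← Finset.card_filter]
    have hsub : ((Finset.range (blockLen n)).filter fun o => blockLen n < o + l) ⊆
        Finset.Ico (blockLen n - l) (blockLen n) := by
      intro o ho
      rw [Finset.mem_filter, Finset.mem_range] at ho
      rw [Finset.mem_Ico]
      omega
    refine (Finset.card_le_card hsub).trans ?_
    rw [Nat.card_Ico]; omega
  have hsub : ((Finset.range (n * 2 ^ n)).image fun r => win seqS (zoneStart n + r) l) ⊆
      ((Finset.range (2 ^ n)).image fun c => win (dbSeq n) c l) ∪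
        X.image fun r => win seqS (zoneStart n + r) l := by
    intro u hu
    obtain ⟨r, hr, rfl⟩ := Finset.mem_image.1 hu
    rw [Finset.mem_union]
    by_cases hc : blockLen n < r % blockLen n + l
    · right
      exact Finset.mem_image_of_mem (fun r => win seqS (zoneStart n + r) l)
        (Finset.mem_filter.2 ⟨hr, hc⟩)
    · left
      rw [Finset.mem_image]
      refine ⟨(r + r / blockLen n) % 2 ^ n, Finset.mem_range.2 (Nat.mod_lt _ (by positivity)), ?_⟩
      rw [win_eq_win_iff]
      intro i hi
      rw [Finset.mem_range, ← numBlocks_mul_blockLen] at hr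
      have hk : r / blockLen n < numBlocks n := (Nat.div_lt_iff_lt_mul hB).2 hr
      have hk' : (r / blockLen n + 1) * blockLen n ≤ numBlocks n * blockLen n :=
        Nat.mul_le_mul_right _ hk
      have hr' := Nat.div_add_mod' r (blockLen n)
      rw [Nat.succ_mul] at hk'
      have hdiv : (r + i) / blockLen n = r / blockLen n := by
        rw [Nat.div_eq_iff hB]
        constructor <;> omega
      rw [add_assoc, seqS_zone hn.ne' (by rw [← numBlocks_mul_blockLen]; omega), hdiv,
        ← dbSeq_mod, Nat.mod_add_mod, dbSeq_mod]
      congr 1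
      omega
  refine (Finset.card_le_card hsub).trans ((Finset.card_union_le _ _).trans ?_)
  refine Nat.add_le_add (Finset.card_image_le.trans (by simp)) (Finset.card_image_le.trans hXcard)

theorem card_windows_le (n l : ℕ) :
    (windows (zoneStart (n + 1)) l).card ≤ 2 ^ (n + 1) + n * (n + 1) * l := by
  classical
  have key : ∀ m ≤ n + 1, (windows (zoneStart m) l).card ≤ 2 ^ m + m * (n * l) := by
    intro m
    induction m with
    | zero => simp [windows, zoneStart]
    | succ m ih =>
      intro hm
      have h1 := ih (by omega)
      have h2 := card_windows_zone_le m l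
      have hsub : windows (zoneStart (m + 1)) l ⊆ windows (zoneStart m) l ∪
          (Finset.range (m * 2 ^ m)).image fun r => win seqS (zoneStart m + r) l := by
        intro u hu
        obtain ⟨p, hp, rfl⟩ := Finset.mem_image.1 hu
        rw [Finset.mem_range, zoneStart_succ] at hp
        rw [Finset.mem_union]
        by_cases hc : p < zoneStart m
        · left
          exact Finset.mem_image_of_mem (fun p => win seqS p l) (Finset.mem_range.2 hc)
        · right
          rw [Finset.mem_image]
          exact ⟨p - zoneStart m, Finset.mem_range.2 (by omega), by
            rw [Nat.add_sub_cancel' (by omega)]⟩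
      have h3 := (Finset.card_le_card hsub).trans (Finset.card_union_le _ _)
      have h4 : m * l ≤ n * l := Nat.mul_le_mul_right _ (by omega)
      rw [pow_succ, Nat.succ_mul]
      omega
  exact (key (n + 1) le_rfl).trans (by ring_nf; rfl)

/-- All but few bits are encoded by PPM* with a probability close to 1. -/
theorem exists_exceptional_bits (n A : ℕ) (hn : 0 < n) (hA : 0 < A) :
    ∃ X : Finset ℕ, X.card ≤ (A + 1) * (2 ^ (n + 2) + (n * (n + 1) + 1) * (n + n ^ 3)) ∧
      ∀ q < zoneStart (n + 1), q ∉ X → 1 - 1 / ((A : ℚ) + 1) ≤ bitWidth starContexts seqS q := by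
  classical
  set M := zoneStart (n + 1) with hM
  -- The factor n^3 outweighs the multiplicity n(n + 1) and the factor n in M ≤ n 2^(n+1).
  obtain ⟨l, hl1, hl2, hl3⟩ := exists_few_special M n (K := n ^ 3) (by positivity)
  set X₁ := (Finset.range M).filter fun p => win seqS p l ∈ specialWindows M l
  set X₂ := (Finset.range M).filter fun p => rank l p < A
  -- The shift by l leads from the start of a window to the bit that it predicts.
  refine ⟨Finset.range l ∪ (X₁ ∪ X₂).image fun p => p + l, ?_, ?_⟩
  · have h0 : (Finset.range l ∪ (X₁ ∪ X₂).image fun p => p + l).card ≤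
        l + (X₁.card + X₂.card) := by
      refine (Finset.card_union_le _ _).trans ?_
      rw [Finset.card_range]
      exact Nat.add_le_add_left (Finset.card_image_le.trans (Finset.card_union_le _ _)) _
    have h1 : X₁.card ≤ n * (n + 1) * (specialWindows M l).card :=
      card_special_positions_le n l hl1 M hM
    have h2 : X₂.card ≤ A * (2 ^ (n + 1) + n * (n + 1) * l) :=
      (card_rank_lt_le M l A).trans (Nat.mul_le_mul_left _ (card_windows_le n l))
    have hMle : M ≤ n * 2 ^ (n + 1) := by
      obtain ⟨a, rfl⟩ : ∃ a, n = a + 1 := ⟨n - 1, by omega⟩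
      rw [hM, zoneStart_add_two_pow, Nat.succ_mul, show a + 1 + 1 = a + 2 from rfl]
      have : 2 ^ 1 ≤ 2 ^ (a + 2) := Nat.pow_le_pow_right (by omega) (by omega)
      omega
    have h3 : n * (n + 1) * (specialWindows M l).card ≤ 2 ^ (n + 2) := by
      refine Nat.le_of_mul_le_mul_left ?_ hn
      calc n * (n * (n + 1) * (specialWindows M l).card)
          ≤ n * (n * (n + n) * (specialWindows M l).card) := by gcongr; omega
        _ = 2 * (n ^ 3 * (specialWindows M l).card) := by ring
        _ ≤ 2 * (n * 2 ^ (n + 1)) := Nat.mul_le_mul_left _ (hl3.trans hMle)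
        _ = n * 2 ^ (n + 2) := by ring
    have h4 : n * (n + 1) * l ≤ n * (n + 1) * (n + n ^ 3) := Nat.mul_le_mul_left _ hl2.le
    have h5 : A * (2 ^ (n + 1) + n * (n + 1) * l) ≤
        A * (2 ^ (n + 2) + (n * (n + 1) + 1) * (n + n ^ 3)) := by
      refine Nat.mul_le_mul_left _ (Nat.add_le_add (Nat.pow_le_pow_right (by omega) (by omega)) ?_)
      rw [Nat.succ_mul]; omega
    rw [Nat.succ_mul]
    have h6 : (n * (n + 1) + 1) * (n + n ^ 3) = n * (n + 1) * (n + n ^ 3) + (n + n ^ 3) :=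
      Nat.succ_mul _ _
    omega
  · intro q hq hqX
    rw [Finset.mem_union, not_or, Finset.mem_range, Finset.mem_image] at hqX
    have hlq : l ≤ q := by omega
    have hpX : q - l ∉ X₁ ∪ X₂ := fun h => hqX.2 ⟨q - l, h, by omega⟩
    rw [Finset.mem_union, not_or, Finset.mem_filter, Finset.mem_filter, Finset.mem_range] at hpX
    have hpM : q - l < M := by omega
    have hrank : A ≤ rank l (q - l) := by
      by_contra h
      exact hpX.2 ⟨hpM, by omega⟩
    have hsp : win seqS (q - l) l ∉ specialWindows M l := fun h => hpX.1 ⟨hpM, h⟩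
    refine le_bitWidth_star_of_repeat hlq hA hrank fun p hp h => ?_
    by_contra hne
    apply hsp
    refine Finset.mem_filter.2
      ⟨Finset.mem_image_of_mem (fun p => win seqS p l) (Finset.mem_range.2 hpM), fun b => ?_⟩
    have e1 : win seqS (q - l) l ++ [seqS q] ∈ windows M (l + 1) := by
      have : win seqS (q - l) (l + 1) = win seqS (q - l) l ++ [seqS q] := by
        rw [win_succ, Nat.sub_add_cancel hlq]
      rw [← this]
      exact Finset.mem_image_of_mem (fun p => win seqS p (l + 1)) (Finset.mem_range.2 hpM)
    have e2 : win seqS (q - l) l ++ [seqS (p + l)] ∈ windows M (l + 1) := by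
      rw [← h, ← win_succ]
      exact Finset.mem_image_of_mem (fun p => win seqS p (l + 1)) (Finset.mem_range.2 (by omega))
    by_cases hb : b = seqS q
    · rwa [hb]
    · have : b = seqS (p + l) := by
        revert hb hne
        cases b <;> cases seqS q <;> cases seqS (p + l) <;> simp
      rwa [this]

/-! ### The compression ratio of PPM* -/

/-- B good bits cost at most one output bit in all, by Bernoulli's inequality; each exceptional bit
costs at most 2τ more. -/
theorem codeLength_prod_le {f : ℕ → ℚ} {N B T τ : ℕ} (hB : 0 < B) (hT : 0 < T) (hτ : T ≤ 2 ^ τ)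
    (X : Finset ℕ) (h1 : ∀ q < N, (1 : ℚ) / T ^ 2 ≤ f q)
    (h2 : ∀ q < N, q ∉ X → 1 - 1 / (((2 * B : ℕ) : ℚ) + 1) ≤ f q) :
    codeLength (∏ q ∈ Finset.range N, f q) ≤ N / B + 1 + 2 * τ * X.card := by
  classical
  set ρ : ℚ := 1 - 1 / (((2 * B : ℕ) : ℚ) + 1) with hρ
  have hB' : (1 : ℚ) ≤ B := by exact_mod_cast hB
  have hρ0 : 0 < ρ := by
    rw [hρ, sub_pos, div_lt_one (by positivity)]; push_cast; linarith
  have hρ1 : ρ ≤ 1 := by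
    rw [hρ, sub_le_self_iff]; positivity
  have hρB : 1 / 2 ≤ ρ ^ B := by
    have hbern := one_add_mul_le_pow (a := -(1 / (((2 * B : ℕ) : ℚ) + 1))) (by
      have : 1 / (((2 * B : ℕ) : ℚ) + 1) ≤ 1 :=
        div_le_one_of_le₀ (by push_cast; linarith) (by positivity)
      linarith) B
    rw [← sub_eq_add_neg, ← hρ] at hbern
    refine le_trans ?_ hbern
    have : (B : ℚ) * (1 / (((2 * B : ℕ) : ℚ) + 1)) ≤ 1 / 2 := by
      rw [mul_one_div, div_le_div_iff₀ (by positivity) (by norm_num)]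
      push_cast; linarith
    linarith
  have hρN : (1 / 2 : ℚ) ^ (N / B + 1) ≤ ρ ^ N := by
    calc (1 / 2 : ℚ) ^ (N / B + 1) ≤ (ρ ^ B) ^ (N / B + 1) := by gcongr
      _ = ρ ^ (B * (N / B + 1)) := (pow_mul _ _ _).symm
      _ ≤ ρ ^ N := pow_le_pow_of_le_one hρ0.le hρ1 (Nat.lt_mul_div_succ N hB).le
  have hT' : (1 : ℚ) ≤ T := by exact_mod_cast hT
  set t : ℚ := 1 / T ^ 2 with ht
  have ht0 : 0 < t := by positivity
  have ht1 : t ≤ 1 := div_le_one_of_le₀ (one_le_pow₀ hT') (by positivity)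
  have htτ : (1 / 2 : ℚ) ^ (2 * τ) ≤ t := by
    rw [ht, one_div_pow, mul_comm, pow_mul]
    refine one_div_le_one_div_of_le (by positivity) ?_
    have : (T : ℚ) ≤ 2 ^ τ := by exact_mod_cast hτ
    gcongr
  have hprod : ρ ^ N * t ^ X.card ≤ ∏ q ∈ Finset.range N, f q := by
    calc ρ ^ N * t ^ X.card
        ≤ ρ ^ N * t ^ ((Finset.range N).filter fun q => q ∈ X).card := by
          refine mul_le_mul_of_nonneg_left (pow_le_pow_of_le_one ht0.le ht1 ?_) (by positivity)
          exact Finset.card_le_card fun q hq => (Finset.mem_filter.1 hq).2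
      _ = ∏ q ∈ Finset.range N, ρ * (if q ∈ X then t else 1) := by
          rw [Finset.prod_mul_distrib, Finset.prod_const, Finset.card_range, Finset.prod_ite]
          simp
      _ ≤ ∏ q ∈ Finset.range N, f q := by
          refine Finset.prod_le_prod (fun q _ => ?_) fun q hq => ?_
          · split_ifs <;> positivity
          · rw [Finset.mem_range] at hq
            split_ifs with hX
            · exact (mul_le_of_le_one_left ht0.le hρ1).trans (h1 q hq)
            · rw [mul_one]; exact h2 q hq hX
  refine codeLength_le_of_inv_le (inv_le_of_inv_le₀ (by positivity) ?_)
  refine le_trans ?_ hprod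
  rw [← inv_pow, pow_add, pow_mul, ← one_div]
  exact mul_le_mul hρN (pow_le_pow_left₀ (by positivity) htτ _) (by positivity) (by positivity)

/-- The bound n/h on the logarithm of 8(n + 1)^2 is crude, but suffices because h is arbitrary. -/
theorem eventually_pow_le_two_pow_div (h : ℕ) (hh : 0 < h) :
    ∀ᶠ n : ℕ in atTop, 8 * (n + 1) ^ 2 ≤ 2 ^ (n / h) := by
  have h1 : ∀ᶠ m : ℕ in atTop, 8 * (h * (m + 1) + 1) ^ 2 ≤ 2 ^ m := by
    have hlim := tendsto_pow_const_div_const_pow_of_one_lt 2 (show (1 : ℝ) < 2 by norm_num)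
    have hev := hlim.eventually (gt_mem_nhds (show (0 : ℝ) < 1 / (8 * (3 * h) ^ 2) by positivity))
    filter_upwards [hev, eventually_ge_atTop 1] with m hm hm1
    rw [div_lt_div_iff₀ (by positivity) (by positivity)] at hm
    have h2 : m ^ 2 * (8 * (3 * h) ^ 2) < 1 * 2 ^ m := by exact_mod_cast hm
    have h3 : h * (m + 1) + 1 ≤ 3 * h * m := by nlinarith
    have h4 := Nat.pow_le_pow_left h3 2
    calc _ ≤ 8 * (3 * h * m) ^ 2 := Nat.mul_le_mul_left _ h4
      _ = m ^ 2 * (8 * (3 * h) ^ 2) := by ring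
      _ ≤ _ := by omega
  filter_upwards [(Nat.tendsto_div_const_atTop hh.ne').eventually h1] with n hn
  refine le_trans ?_ hn
  have := (Nat.lt_mul_div_succ n hh).le
  gcongr

theorem eventually_poly_le_two_pow :
    ∀ᶠ n : ℕ in atTop, (n * (n + 1) + 1) * (n + n ^ 3) ≤ 2 ^ (n + 2) := by
  have hlim := tendsto_pow_const_div_const_pow_of_one_lt 5 (show (1 : ℝ) < 2 by norm_num)
  have hev := hlim.eventually (gt_mem_nhds (show (0 : ℝ) < 1 / 6 by positivity))
  filter_upwards [hev, eventually_ge_atTop 1] with n hn hn1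
  rw [div_lt_div_iff₀ (by positivity) (by positivity)] at hn
  have h2 : n ^ 5 * 6 < 1 * 2 ^ n := by exact_mod_cast hn
  have h3 : n * (n + 1) + 1 ≤ 3 * n ^ 2 := by nlinarith
  have h4 : n + n ^ 3 ≤ 2 * n ^ 3 := by
    have : n ^ 1 ≤ n ^ 3 := Nat.pow_le_pow_right hn1 (by omega)
    rw [pow_one] at this
    omega
  calc _ ≤ (3 * n ^ 2) * (2 * n ^ 3) := Nat.mul_le_mul h3 h4
    _ = n ^ 5 * 6 := by ring
    _ ≤ 2 ^ n := by omega
    _ ≤ _ := Nat.pow_le_pow_right (by omega) (by omega)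

theorem eventually_mul_length_star_le (B : ℕ) (hB : 0 < B) :
    ∀ᶠ N in atTop, B * (star (initSeg seqS N)).length ≤ 34 * N := by
  -- Chosen to cancel B and the factor 2B + 1 in the bound on the exceptional bits.
  set h := (2 * B + 1) * B with hh
  have hh0 : 0 < h := by positivity
  obtain ⟨n₀, hn₀⟩ := eventually_atTop.1
    ((eventually_pow_le_two_pow_div h hh0).and
      (eventually_poly_le_two_pow.and (eventually_ge_atTop 4)))
  filter_upwards [eventually_ge_atTop (zoneStart n₀), eventually_ge_atTop B] with N hN hNB
  obtain ⟨n, hnN, hNn⟩ := exists_zone N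
  have hn : n₀ ≤ n := by
    by_contra hlt
    have := zoneStart_mono (show n + 1 ≤ n₀ by omega)
    omega
  obtain ⟨hτ, hpoly, hn4⟩ := hn₀ n hn
  obtain ⟨X, hX, hgood⟩ := exists_exceptional_bits n (2 * B) (by omega) (by omega)
  have hcode : (star (initSeg seqS N)).length ≤ N / B + 1 + 2 * (n / h) * X.card := by
    rw [star, length_outputBits_encodeFrom]
    exact codeLength_prod_le hB (by positivity) hτ X
      (fun q hq => le_bitWidth_star_seqS (hq.trans hNn)) fun q hq => hgood q (hq.trans hNn)
  have hX' : X.card ≤ (2 * B + 1) * (2 * 2 ^ (n + 2)) :=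
    hX.trans (Nat.mul_le_mul_left _ (by omega))
  have h1 : B * (2 * (n / h) * X.card) ≤ 16 * (n * 2 ^ n) := by
    calc B * (2 * (n / h) * X.card)
        ≤ B * (2 * (n / h) * ((2 * B + 1) * (2 * 2 ^ (n + 2)))) := by gcongr
      _ = 16 * ((n / h * h) * 2 ^ n) := by rw [hh]; ring
      _ ≤ _ := by gcongr; exact Nat.div_mul_le_self n h
  have h2 : n * 2 ^ n ≤ 2 * N := by
    obtain ⟨a, rfl⟩ : ∃ a, n = a + 2 := ⟨n - 2, by omega⟩
    rw [zoneStart_add_two_pow] at hnN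
    have : (a + 2) * 2 ^ (a + 2) ≤ (2 * a) * 2 ^ (a + 2) := Nat.mul_le_mul_right _ (by omega)
    rw [mul_assoc] at this
    omega
  have h3 : B * (N / B) ≤ N := Nat.mul_div_le N B
  calc _ ≤ B * (N / B + 1 + 2 * (n / h) * X.card) := Nat.mul_le_mul_left _ hcode
    _ = B * (N / B) + B + B * (2 * (n / h) * X.card) := by ring
    -- 34 = 1 + 1 + 16 · 2, from `h3`, B ≤ N, and `h1` with `h2`.
    _ ≤ 34 * N := by omega

theorem worstRatio_star_seqS : worstRatio star seqS = 0 := by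
  have hle : ∀ B : ℕ, worstRatio star seqS ≤ 34 / (B : ℝ≥0∞) := by
    intro B
    rcases Nat.eq_zero_or_pos B with rfl | hB
    · rw [Nat.cast_zero, ENNReal.div_zero (by norm_num)]
      exact le_top
    refine limsup_le_of_le (by isBoundedDefault) ?_
    filter_upwards [eventually_mul_length_star_le B hB, eventually_gt_atTop 0] with N hN h0
    have hB0 : (B : ℝ≥0∞) ≠ 0 := by exact_mod_cast hB.ne'
    refine ENNReal.div_le_of_le_mul ?_
    rw [← ENNReal.mul_div_right_comm, ENNReal.le_div_iff_mul_le (Or.inl hB0) (by simp), mul_comm]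
    exact_mod_cast hN
  have hlim : Tendsto (fun B : ℕ => 34 / (B : ℝ≥0∞)) atTop (nhds 0) := by
    have := ENNReal.Tendsto.const_div ENNReal.tendsto_nat_nhds_top (a := 34) (by simp)
    simpa using this
  exact le_antisymm (ge_of_tendsto' hlim hle) zero_le

end PPM

theorem theorem3 :
    PPM.worstRatio PPM.star PPM.seqS = 0 ∧
    (∀ k : ℕ, (1 / 2 : ENNReal) ≤ PPM.bestRatio (PPM.bounded k) PPM.seqS) ∧
    (∀ (n k : ℕ) (x : List Bool) (b : Bool), k < n → x.length = k →
      PPM.occ (x ++ [b]) (PPM.zone n ++ (PPM.zone (n + 1)).take k) = n * 2 ^ (n - k - 1)) := by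
  refine ⟨PPM.worstRatio_star_seqS, PPM.half_le_bestRatio_bounded, fun n k x b hk hx => ?_⟩
  have := PPM.occ_zone (n := n) (x ++ [b]) (by simp) (by simp; omega)
  simpa [hx, Nat.sub_sub] using this
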